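/- Let $(M,J,g,\omega)$ be a compact Kähler manifold without boundary, of complex dimension $n\ge 1$, with Kähler metric $g$, Kähler form $\omega(v,w)=g(Jv,w)$, volume measure $d\mu=\omega^n/n!$, and total volume $\mathrm{Vol}(M,g)=1$. Let $\Delta_g=d\delta+\delta d$ be the (nonnegative) Laplacian, $d^c=i(\bar\partial-\partial)$, and denote by $g(\cdot,\cdot)$ also the pointwise inner product on real $(1,1)$-forms induced by $g$, normalized so that $g(\omega,\omega)=n$. Let $\alpha$ be a smooth $d$-closed real $(1,1)$-form on $M$ with $\int_M g(\alpha,\omega)\,d\mu=0$. For real $t$ near $0$ let $\widetilde g_t$ be the metric with Kähler form $\omega+t\alpha$, and let $$g_t:=\mathrm{Vol}(M,\widetilde g_t)^{-1/n}\,\widetilde g_t .$$ Theorem. (a) The form $\omega+t\alpha$ is a Kähler form for all sufficiently small $|t|$. (b) For every smooth function $f:M\to\mathbb R$, the function $t\mapsto \Delta_{g_t}f$ is pointwise differentiable at $t=0$, and $$\left.\frac{d}{dt}\right|_{t=0}\Delta_{g_t}f=g(dd^cf,\alpha)\quad\text{on } M;$$ moreover $g(f\,dd^cf,\alpha)$ is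 integrable and $$\int_M f\left(\left.\frac{d}{dt}\right|_{t=0}\Delta_{g_t}f\right)d\mu=\int_M g(f\,dd^cf,\alpha)\,d\mu .$$ (c) For $\lambda\in\mathbb R$ let $E_\lambda(g)=\{f\in C^\infty(M;\mathbb R):\Delta_gf=\lambda f\}$, let $\Pi_\lambda$ be the orthogonal projection of $L^2(M,g)$ onto (the closure of) $E_\lambda(g)$, and for $f\in E_\lambda(g)$ let $$Q_\alpha(f):=\int_M f\;\Pi_\lambda\!\left(\left.\frac{d}{dt}\right|_{t=0}\Delta_{g_t}f\right)d\mu .$$ Then $\left.\frac{d}{dt}\right|_{t=0}\Delta_{g_t}f\in L^2(M,g)$ and $$Q_\alpha(f)=\int_M g(f\,dd^cf,\alpha)\,d\mu\qquad\text{for every } f\in E_\lambda(g).$$ -/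

import Mathlib

open scoped Manifold ContDiff Topology
open MeasureTheory Filter

noncomputable section

namespace KahlerDeformation

/-- The model space `ℂⁿ` of complex manifolds of complex dimension `n`. -/
abbrev Cn (n : ℕ) : Type := Fin n → ℂ

section Forms

variable (n : ℕ) {M : Type*} [TopologicalSpace M] [ChartedSpace (Cn n) M]

/-- The real tangent space of `M` at `x`. -/
abbrev Tan (x : M) : Type := TangentSpace 𝓘(ℝ, Cn n) x

/-- The complex structure `J` of `T_x M`: multiplication by `i`.  It does not depend on charts,
because the transition maps of a complex manifold are holomorphic. -/
def J (x : M) : Tan n x →L[ℝ] Tan n x :=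
  ((Complex.I • ContinuousLinearMap.id ℂ (Cn n)).restrictScalars ℝ : Cn n →L[ℝ] Cn n)

variable (M) in
/-- Real differential forms of degree `k` on `M` (without regularity). -/
abbrev DForm (k : ℕ) : Type _ := ∀ x : M, Tan n x [⋀^Fin k]→L[ℝ] ℝ

variable (M) in
/-- Fields of real bilinear forms on the tangent spaces (without regularity);
Riemannian metrics are used through their underlying fields. -/
abbrev BilinField : Type _ := ∀ x : M, LinearMap.BilinForm ℝ (Tan n x)

variable {n}

/-- The coordinate expression of a form in a chart `e`: the pullback under `e.symm`. -/
def inChart {k : ℕ} (α : DForm n M k) (e : OpenPartialHomeomorph M (Cn n)) (y : Cn n) :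
    Cn n [⋀^Fin k]→L[ℝ] ℝ :=
  (α (e.symm y)).compContinuousLinearMap (mfderiv 𝓘(ℝ, Cn n) 𝓘(ℝ, Cn n) e.symm y)

/-- A form is smooth if its coordinate expressions are. -/
def IsSmoothForm {k : ℕ} (α : DForm n M k) : Prop :=
  ∀ e ∈ atlas (Cn n) M, ContDiffOn ℝ ∞ (inChart α e) e.target

/-- The exterior derivative, computed at `x` in the preferred chart at `x`. -/
def extD {k : ℕ} (α : DForm n M k) : DForm n M (k + 1) := fun x =>
  (extDeriv (inChart α (chartAt (Cn n) x)) (chartAt (Cn n) x x)).compContinuousLinearMap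
    (mfderiv 𝓘(ℝ, Cn n) 𝓘(ℝ, Cn n) (chartAt (Cn n) x) x)

variable (n) in
/-- The differential of a real function at a point, as a linear form. -/
def dAt (f : M → ℝ) (x : M) : Tan n x →L[ℝ] ℝ := mfderiv 𝓘(ℝ, Cn n) 𝓘(ℝ, ℝ) f x

variable (n) in
/-- The differential `df` as a 1-form. -/
def dFun (f : M → ℝ) : DForm n M 1 := fun x =>
  ContinuousAlternatingMap.ofSubsingleton ℝ (Tan n x) ℝ (0 : Fin 1) (dAt n f x)

variable (n) in
/-- `∂f`, the complex-linear part of `df`. -/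
def del (f : M → ℝ) (x : M) (v : Tan n x) : ℂ :=
  ((dAt n f x v : ℂ) - Complex.I * (dAt n f x (J n x v) : ℂ)) / 2

variable (n) in
/-- `∂̄f`, the complex-antilinear part of `df`. -/
def delbar (f : M → ℝ) (x : M) (v : Tan n x) : ℂ :=
  ((dAt n f x v : ℂ) + Complex.I * (dAt n f x (J n x v) : ℂ)) / 2

variable (n) in
/-- The twisted differential `d^c f = i (∂̄f - ∂f) = - df ∘ J` as a 1-form. -/
def dcFun (f : M → ℝ) : DForm n M 1 := fun x =>
  ContinuousAlternatingMap.ofSubsingleton ℝ (Tan n x) ℝ (0 : Fin 1) (-(dAt n f x).comp (J n x))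

/-- The definition of `d^c f` agrees with `i (∂̄f - ∂f)`. -/
theorem dcFun_eq (f : M → ℝ) (x : M) (v : Fin 1 → Tan n x) :
    ((dcFun n f x v : ℝ) : ℂ) = Complex.I * (delbar n f x (v 0) - del n f x (v 0)) := by
  have h : dcFun n f x v = -(dAt n f x (J n x (v 0))) := rfl
  rw [h, del, delbar]
  push_cast
  linear_combination ((dAt n f x (J n x (v 0)) : ℝ) : ℂ) * (-Complex.I_mul_I)

variable (n) in
/-- `dd^c f` for a real function `f`. -/
def ddc (f : M → ℝ) : DForm n M 2 := extD (dcFun n f)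

/-- A real 2-form is of type `(1,1)` iff it is `J`-invariant. -/
def IsOneOne (α : DForm n M 2) : Prop :=
  ∀ (x : M) (v w : Tan n x), α x ![J n x v, J n x w] = α x ![v, w]

/-- `Z^{1,1}(M; ℝ)`: smooth `d`-closed real `(1,1)`-forms. -/
def IsClosedOneOne (α : DForm n M 2) : Prop :=
  IsSmoothForm α ∧ IsOneOne α ∧ extD α = 0

/-- The symmetric form `g(v, w) = ω(v, J w)` associated with a real `(1,1)`-form `ω`;
equivalently `ω(v, w) = g(J v, w)`. -/
def metricOf (Ω : DForm n M 2) : BilinField n M := fun x =>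
  LinearMap.mk₂ ℝ (fun v w => Ω x ![v, J n x w])
    (fun v v' w => (Ω x).toAlternatingMap.map_vecCons_add ![J n x w] v v')
    (fun c v w => (Ω x).toAlternatingMap.map_vecCons_smul ![J n x w] c v)
    (fun v w w' => by
      have h := (Ω x).map_update_add ![v, 0] 1 (J n x w) (J n x w')
      have e : ∀ u : Tan n x, Function.update ![v, 0] 1 u = ![v, u] := fun u => by
        ext i
        fin_cases i <;> rfl
      rw [e, e, e] at h
      rw [map_add, h])
    (fun c v w => by
      have h := (Ω x).map_update_smul ![v, 0] 1 c (J n x w)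
      have e : ∀ u : Tan n x, Function.update ![v, 0] 1 u = ![v, u] := fun u => by
        ext i
        fin_cases i <;> rfl
      rw [e, e] at h
      rw [map_smul, h])

/-- `ω` is a Kähler form: a closed smooth real `(1,1)`-form such that
`g(v, w) = ω(v, J w)` is positive definite, so that `g` is a Kähler metric. -/
def IsKahlerForm (Ω : DForm n M 2) : Prop :=
  IsClosedOneOne Ω ∧ ∀ (x : M) (v : Tan n x), v ≠ 0 → 0 < metricOf Ω x v v

end Forms

section Riemannian

variable {n : ℕ} {M : Type*} [TopologicalSpace M] [ChartedSpace (Cn n) M]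

/-- The standard real basis of `ℂⁿ`: `basisVec (j, 0) = ∂/∂x_j`, `basisVec (j, 1) = ∂/∂y_j`. -/
def basisVec (a : Fin n × Fin 2) : Cn n :=
  Pi.single a.1 (if a.2 = 0 then 1 else Complex.I)

/-- The matrix `(g_{ab})` of `g` in the real coordinates of a chart `e`, at the point with
coordinates `y`. -/
def gramIn (g : BilinField n M) (e : OpenPartialHomeomorph M (Cn n)) (y : Cn n) :
    Matrix (Fin n × Fin 2) (Fin n × Fin 2) ℝ :=
  Matrix.of fun a b =>
    g (e.symm y) (mfderiv 𝓘(ℝ, Cn n) 𝓘(ℝ, Cn n) e.symm y (basisVec a))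
      (mfderiv 𝓘(ℝ, Cn n) 𝓘(ℝ, Cn n) e.symm y (basisVec b))

/-- The codifferential of a 1-form in the real coordinates of a chart `e`,
`δη = - (det g)^{-1/2} ∑_a ∂_a ((det g)^{1/2} ∑_b g^{ab} η_b)`,
at the point with coordinates `y`. -/
def codiffIn (g : BilinField n M) (η : DForm n M 1) (e : OpenPartialHomeomorph M (Cn n))
    (y : Cn n) : ℝ :=
  -((√(gramIn g e y).det)⁻¹ *
    ∑ a, fderiv ℝ (fun z => √(gramIn g e z).det *
      ∑ b, (gramIn g e z)⁻¹ a b * inChart η e z ![basisVec b]) y (basisVec a))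

/-- The codifferential `δη` of a 1-form (the adjoint of `d` with respect to the Riemannian volume
of `g`), computed at `x` in the preferred chart at `x`. -/
def codiff (g : BilinField n M) (η : DForm n M 1) (x : M) : ℝ :=
  codiffIn g η (chartAt (Cn n) x) (chartAt (Cn n) x x)

/-- The (nonnegative) Laplacian on functions, `Δ_g f = δ d f`. -/
def laplacian (g : BilinField n M) (f : M → ℝ) (x : M) : ℝ :=
  codiff g (dFun n f) x

/-- The matrix of `g` at `x` in the standard real basis of `T_x M`. -/
def gramAt (g : BilinField n M) (x : M) : Matrix (Fin n × Fin 2) (Fin n × Fin 2) ℝ :=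
  Matrix.of fun a b => g x (basisVec a : Cn n) (basisVec b : Cn n)

/-- The inner product of 2-forms at `x` induced by `g`,
`g(α, β) = (1/2) ∑ g^{ac} g^{bd} α_{ab} β_{cd}`, normalized so that `g(ω, ω) = n`
for the Kähler form `ω` of `g`. -/
def formInner (g : BilinField n M) (x : M) (α β : Tan n x [⋀^Fin 2]→L[ℝ] ℝ) : ℝ :=
  (1 / 2) * ∑ a, ∑ b, ∑ c, ∑ d, (gramAt g x)⁻¹ a c * (gramAt g x)⁻¹ b d *
    α ![(basisVec a : Cn n), (basisVec b : Cn n)] * β ![(basisVec c : Cn n), (basisVec d : Cn n)]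

variable [MeasurableSpace M]

/-- The Riemannian volume measure on the domain of a chart: `(det g)^{1/2}` times the Lebesgue
measure of `ℂⁿ = ℝ²ⁿ`, transported to `M`. -/
def chartVol (g : BilinField n M) (e : OpenPartialHomeomorph M (Cn n)) : Measure M :=
  Measure.map e.symm
    ((volume.withDensity fun y => ENNReal.ofReal √(gramIn g e y).det).restrict e.target)

/-- The Riemannian volume measure of `g`: by the change of variables formula the measures
`chartVol g e` agree on overlaps, and their supremum is the measure that restricts to
`chartVol g e` on the domain of every chart `e`. -/
def volMeasure (g : BilinField n M) : Measure M :=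
  ⨆ e ∈ atlas (Cn n) M, chartVol g e

/-- The total volume `Vol(M, g)`. -/
def vol (g : BilinField n M) : ℝ := (volMeasure g).real Set.univ

/-- `Z^{1,1}_0(M; ℝ)`: closed real `(1,1)`-forms `α` with `∫ g(α, ω) dμ = 0`. -/
def IsClosedOneOneZero (Ω α : DForm n M 2) : Prop :=
  IsClosedOneOne α ∧ ∫ x, formInner (metricOf Ω) x (α x) (Ω x) ∂volMeasure (metricOf Ω) = 0

/-- The volume-normalized deformation `g_t = Vol(M, g̃_t)^{-1/n} g̃_t`, where `g̃_t` is the metric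
with Kähler form `ω + t α`. -/
def deformedMetric (Ω α : DForm n M 2) (t : ℝ) : BilinField n M :=
  (vol (metricOf (Ω + t • α)) ^ (-1 / (n : ℝ))) • metricOf (Ω + t • α)

/-- `(d/dt)|_{t=0} Δ_{g_t} f`. -/
def laplacianVariation (Ω α : DForm n M 2) (f : M → ℝ) (x : M) : ℝ :=
  deriv (fun t : ℝ => laplacian (deformedMetric Ω α t) f x) 0

/-- Membership in the eigenspace `Ker(Δ_g - lam)` on smooth real functions. -/
def IsEigenfunction (g : BilinField n M) (lam : ℝ) (f : M → ℝ) : Prop :=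
  ContMDiff 𝓘(ℝ, Cn n) 𝓘(ℝ, ℝ) ∞ f ∧ ∀ x, laplacian g f x = lam * f x

/-- The eigenspace as a closed subspace of `L²(M, g)`.  (Taking span and closure changes nothing
on a compact manifold, where the eigenspaces are finite-dimensional.) -/
def eigenspaceL2 (g : BilinField n M) (lam : ℝ) : Submodule ℝ (Lp ℝ 2 (volMeasure g)) :=
  (Submodule.span ℝ {u : Lp ℝ 2 (volMeasure g) |
    ∃ f, IsEigenfunction g lam f ∧ u =ᵐ[volMeasure g] f}).topologicalClosure

open Classical in
/-- The class in `L²(M, g)` of a square-integrable function (and `0` for other functions). -/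
def classL2 (g : BilinField n M) (h : M → ℝ) : Lp ℝ 2 (volMeasure g) :=
  if hh : MemLp h 2 (volMeasure g) then hh.toLp h else 0

/-- The operator `P_α f = Π((d/dt)|_{t=0} Δ_{g_t} f)`, where `Π` is the orthogonal projection of
`L²(M, g)` onto the eigenspace. -/
def projectedVariation (Ω α : DForm n M 2) (lam : ℝ) (f : M → ℝ) :
    Lp ℝ 2 (volMeasure (metricOf Ω)) :=
  haveI : CompleteSpace (eigenspaceL2 (metricOf Ω) lam) :=
    (Submodule.isClosed_topologicalClosure _).completeSpace_coe
  (eigenspaceL2 (metricOf Ω) lam).starProjection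
    (classL2 (metricOf Ω) (laplacianVariation Ω α f))

/-- The quadratic form `Q_α(f) = ∫ f P_α(f) dμ` on the eigenspace for `lam`. -/
def quadForm (Ω α : DForm n M 2) (lam : ℝ) (f : M → ℝ) : ℝ :=
  ∫ x, f x * projectedVariation Ω α lam f x ∂volMeasure (metricOf Ω)

end Riemannian

end KahlerDeformation

end

open KahlerDeformation

/-!
Near a point, in holomorphic coordinates, a closed real `(1,1)`-form `ω` is an antisymmetric matrix
`w` of functions, and the Gram matrix of the associated symmetric form is `G = j w` with a constant
matrix `j`.  Closedness of `ω` gives `∑_a ∂_a (√(det w) w⁻¹)_{ac} = 0`, which is Liouville's theorem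
that Hamiltonian fields are divergence free (`sum_liouville_eq_zero`).  Hence the first-order terms
of the Laplacian cancel, and `Δ f = - tr (G⁻¹ Hess f)` in such coordinates
(`laplacian_eq_neg_trace`).  All the metrics `g_t` come from closed `(1,1)`-forms
`c(t) (ω + t α)`, so that differentiating their Laplacians only requires differentiating the inverse
matrix: if `c(0) = 1` and `c'(0) = 0`, the derivative at `t = 0` is `tr (G⁻¹ A G⁻¹ Hess f)`, where
`A` is the symmetric form of `α` (`hasDerivAt_laplacian`).  Since `dd^c f` has the symmetric form
`Hess f + Jᵀ (Hess f) J` and `G`, `A` are `J`-invariant, this trace is `g(dd^c f, α)`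
(`symMat_inChart_ddc`, `innerMat_eq_trace_of_symMat_eq`).

The normalization `c(t) = Vol^{-1/n}` is stationary at `0` because the derivative of the volume is
`∫ g(α, ω) dμ`, which vanishes by hypothesis (`hasDerivAt_vol`).  The volume measure of `ω + t α` is
that of `ω` multiplied by the density `√(det (g + t a) / det g)`.  This holds for the measure of
each chart, and multiplication by an invertible density is an order automorphism of the measures, so
it passes to the supremum over the atlas that defines the volume measure (`iSup_withDensity`,
`volMeasure_add_smul`).  The density is a continuous function of `t` and the point of the compact
manifold, which allows differentiation under the integral.

Compactness of the unit sphere and of the manifold gives the positivity of `ω + t α` for small `t`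
(`eventually_isKahlerForm`).  As the exterior derivative can be computed in any chart
(`inChart_extD`), `g(dd^c f, α)` is continuous and hence bounded, which provides the integrability
statements.  Finally the orthogonal projection to the eigenspace is self-adjoint and fixes `f`, so
it disappears from the quadratic form (`quadForm_eq_integral`).
-/

noncomputable section

namespace KahlerDeformation

/-! ### Matrix calculus and Liouville's theorem -/

section MatrixCalculus

variable {ι : Type*} [Fintype ι]

/-- Jacobi's formula for the derivative of a determinant along a curve of matrices. -/
theorem hasDerivAt_det_adjugate [DecidableEq ι] {G : ℝ → Matrix ι ι ℝ} {H : Matrix ι ι ℝ} {t : ℝ}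
    (hG : ∀ i j, HasDerivAt (fun s => G s i j) (H i j) t) :
    HasDerivAt (fun s => (G s).det) ((G t).adjugate * H).trace t := by
  have h1 : HasDerivAt (fun s => (G s).det)
      (∑ σ : Equiv.Perm ι, ((Equiv.Perm.sign σ : ℤ) : ℝ) *
        ∑ i, (∏ j ∈ Finset.univ.erase i, G t (σ j) j) • H (σ i) i) t := by
    simp only [Matrix.det_apply']
    refine HasDerivAt.fun_sum fun σ _ => ?_
    refine HasDerivAt.const_mul _ ?_
    exact HasDerivAt.fun_finsetProd fun i _ => hG (σ i) i
  convert h1 using 1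
  have h3 : ((G t).adjugate * H).trace = ∑ i, ((G t).updateCol i (fun j => H j i)).det := by
    refine Finset.sum_congr rfl fun i _ => ?_
    rw [← Matrix.cramer_apply, Matrix.cramer_eq_adjugate_mulVec]
    rfl
  rw [h3]
  simp only [Matrix.det_apply', Finset.mul_sum]
  rw [Finset.sum_comm]
  refine Finset.sum_congr rfl fun σ _ => Finset.sum_congr rfl fun i _ => ?_
  rw [← Finset.mul_prod_erase Finset.univ _ (Finset.mem_univ i), Matrix.updateCol_self, smul_eq_mul,
    mul_comm (H (σ i) i)]
  congr 2
  refine Finset.prod_congr rfl fun j hj => ?_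
  rw [Matrix.updateCol_ne (Finset.ne_of_mem_erase hj)]

theorem trace_adjugate_mul [DecidableEq ι] {A : Matrix ι ι ℝ} (hA : A.det ≠ 0)
    (H : Matrix ι ι ℝ) : (A.adjugate * H).trace = A.det * (A⁻¹ * H).trace := by
  have h2 : A.det • A⁻¹ = A.adjugate := by
    rw [Matrix.inv_def, Ring.inverse_eq_inv', smul_smul, mul_inv_cancel₀ hA, one_smul]
  rw [← h2, Matrix.smul_mul, Matrix.trace_smul, smul_eq_mul]

theorem hasDerivAt_det [DecidableEq ι] {G : ℝ → Matrix ι ι ℝ} {H : Matrix ι ι ℝ} {t : ℝ}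
    (hG : ∀ i j, HasDerivAt (fun s => G s i j) (H i j) t) (hdet : (G t).det ≠ 0) :
    HasDerivAt (fun s => (G s).det) ((G t).det * ((G t)⁻¹ * H).trace) t := by
  rw [← trace_adjugate_mul hdet]
  exact hasDerivAt_det_adjugate hG

section Inverse

variable [DecidableEq ι]

-- A complete normed ring structure on matrices, needed only to differentiate the inversion.
attribute [local instance] Matrix.linftyOpNormedRing Matrix.linftyOpNormedAlgebra

theorem hasDerivAt_matrix_inv {G : ℝ → Matrix ι ι ℝ} {H : Matrix ι ι ℝ} {t : ℝ}
    (hG : ∀ i j, HasDerivAt (fun s => G s i j) (H i j) t) (hdet : (G t).det ≠ 0) (i j : ι) :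
    HasDerivAt (fun s => (G s)⁻¹ i j) (-((G t)⁻¹ * H * (G t)⁻¹) i j) t := by
  have h1 : HasDerivAt G H t := hasDerivAt_pi.2 fun i => hasDerivAt_pi.2 fun j => hG i j
  obtain ⟨u, hu⟩ := (Matrix.isUnit_iff_isUnit_det _).2 (isUnit_iff_ne_zero.2 hdet)
  have h2 := hasFDerivAt_ringInverse (𝕜 := ℝ) u
  rw [hu] at h2
  have h3 := h2.comp_hasDerivAt t h1
  have h4 : HasDerivAt (fun s => (G s)⁻¹) (-((G t)⁻¹ * H * (G t)⁻¹)) t := by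
    have e : (fun s => (G s)⁻¹) = Ring.inverse ∘ G :=
      funext fun s => Matrix.nonsing_inv_eq_ringInverse _
    have e' : -((G t)⁻¹ * H * (G t)⁻¹) =
        (-ContinuousLinearMap.mulLeftRight ℝ (Matrix ι ι ℝ) ↑u⁻¹ ↑u⁻¹) H := by
      rw [neg_apply, ContinuousLinearMap.mulLeftRight_apply,
        Matrix.coe_units_inv, hu]
    rw [e, e']
    exact h3
  exact hasDerivAt_pi.1 (hasDerivAt_pi.1 h4 i) j

variable {E : Type*} [NormedAddCommGroup E] [NormedSpace ℝ E]

theorem differentiableAt_matrix_inv {G : E → Matrix ι ι ℝ} {y : E}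
    (hG : ∀ i j, DifferentiableAt ℝ (fun z => G z i j) y) (hdet : (G y).det ≠ 0) (i j : ι) :
    DifferentiableAt ℝ (fun z => (G z)⁻¹ i j) y := by
  have h1 : DifferentiableAt ℝ G y :=
    differentiableAt_pi.2 fun i => differentiableAt_pi.2 fun j => hG i j
  have h2 := h1.inverse ((Matrix.isUnit_iff_isUnit_det _).2 (isUnit_iff_ne_zero.2 hdet))
  have h4 : DifferentiableAt ℝ (fun z => (G z)⁻¹) y := by
    have e : (fun z => (G z)⁻¹) = fun z => Ring.inverse (G z) :=
      funext fun z => Matrix.nonsing_inv_eq_ringInverse _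
    rw [e]
    exact h2
  exact differentiableAt_pi.1 (differentiableAt_pi.1 h4 i) j

end Inverse

variable {E : Type*} [NormedAddCommGroup E] [NormedSpace ℝ E]

theorem differentiableAt_det [DecidableEq ι] {G : E → Matrix ι ι ℝ} {y : E}
    (hG : ∀ i j, DifferentiableAt ℝ (fun z => G z i j) y) :
    DifferentiableAt ℝ (fun z => (G z).det) y := by
  simp only [Matrix.det_apply']
  fun_prop

/-- The algebraic core of Liouville's theorem.  If `w` is the matrix of a symplectic form, `dw a`
its derivative in the `a`-th coordinate direction and the form is closed, then the derivatives
`∂_a (√(det w) w⁻¹)_{ac} = √(det w) (½ tr (w⁻¹ ∂_a w) w⁻¹ - w⁻¹ (∂_a w) w⁻¹)_{ac}` add up to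
zero; here `W = w⁻¹`, and the common factor `√(det w)` is omitted. -/
theorem sum_liouville_eq_zero {W : Matrix ι ι ℝ} {dw : ι → Matrix ι ι ℝ}
    (hW : W.transpose = -W)
    (hclosed : ∀ a i j, dw a i j + dw i j a + dw j a i = 0) (hdw : ∀ a i j, dw a i j = -dw a j i)
    (c : ι) :
    ∑ a, (1 / 2 * (W * dw a).trace * W a c - (W * dw a * W) a c) = 0 := by
  have hW' : ∀ i j, W i j = -W j i := fun i j => by
    have := congrFun (congrFun hW j) i
    simpa using this
  have e1 : ∑ a, (W * dw a).trace * W a c = ∑ a, ∑ i, ∑ j, W i j * dw a j i * W a c := by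
    simp only [Matrix.trace, Matrix.diag, Matrix.mul_apply, Finset.sum_mul]
  have e2 : ∑ a, (W * dw a * W) a c = ∑ a, ∑ i, ∑ j, W a j * dw a j i * W i c := by
    simp only [Matrix.mul_apply, Finset.sum_mul]
  -- Exchanging the two indices contracted with `W a j` and using closedness turns the
  -- second sum into minus itself plus the first sum.
  have e3 : ∑ a, ∑ i, ∑ j, W a j * dw a j i * W i c
      = ∑ a, ∑ i, ∑ j, W j a * dw j a i * W i c := by
    rw [Finset.sum_comm]
    conv_rhs => rw [Finset.sum_comm]
    refine Finset.sum_congr rfl fun i _ => ?_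
    rw [Finset.sum_comm]
  have e4 : ∑ a, ∑ i, ∑ j, W i j * dw a j i * W a c
      = ∑ a, ∑ i, ∑ j, W a j * dw i j a * W i c := by
    rw [Finset.sum_comm]
  have e5 : ∑ a, ∑ i, ∑ j, W a j * dw a j i * W i c + ∑ a, ∑ i, ∑ j, W j a * dw j a i * W i c
      = ∑ a, ∑ i, ∑ j, W a j * dw i j a * W i c := by
    simp only [← Finset.sum_add_distrib]
    refine Finset.sum_congr rfl fun a _ => Finset.sum_congr rfl fun i _ =>
      Finset.sum_congr rfl fun j _ => ?_
    rw [hW' j a]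
    have h1 := hclosed a j i
    have h2 := hdw j a i
    have h3 := hdw i j a
    linear_combination W a j * W i c * h1 - W a j * W i c * h2 - W a j * W i c * h3
  rw [Finset.sum_sub_distrib]
  have e6 : ∑ a, 1 / 2 * (W * dw a).trace * W a c = 1 / 2 * ∑ a, (W * dw a).trace * W a c := by
    rw [Finset.mul_sum]
    exact Finset.sum_congr rfl fun a _ => by ring
  rw [e6, e1, e2, e4]
  linarith

/-- For the matrix `G = j w` of a metric obtained from a closed 2-form `w` with a constant matrix
`j`, the divergence `∑_a ∂_a (√(det G) ∑_b G^{ab} u_b)` has no first-order term in `u`. -/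
theorem sum_fderiv_sqrt_det_mul [DecidableEq ι] {b : ι → E} {G w : E → Matrix ι ι ℝ}
    {jm : Matrix ι ι ℝ} {y : E} {u : E → ι → ℝ}
    (hG : ∀ᶠ z in 𝓝 y, G z = jm * w z) (hj : jm.det ≠ 0) (hdet : 0 < (G y).det)
    (hw : ∀ i j, DifferentiableAt ℝ (fun z => w z i j) y)
    (hu : ∀ i, DifferentiableAt ℝ (fun z => u z i) y)
    (hanti : ∀ z i j, w z i j = -w z j i)
    (hclosed : ∀ a i j, fderiv ℝ (fun z => w z i j) y (b a) + fderiv ℝ (fun z => w z j a) y (b i)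
      + fderiv ℝ (fun z => w z a i) y (b j) = 0) :
    ∑ a, fderiv ℝ (fun z => √(G z).det * ∑ c, (G z)⁻¹ a c * u z c) y (b a) =
      √(G y).det * ∑ a, ∑ c, (G y)⁻¹ a c * fderiv ℝ (fun z => u z c) y (b a) := by
  have hGy : G y = jm * w y := hG.self_of_nhds
  have hwdet : (w y).det ≠ 0 := fun h => by
    rw [hGy, Matrix.det_mul, h, mul_zero] at hdet
    exact lt_irrefl _ hdet
  have hGd : ∀ i j, DifferentiableAt ℝ (fun z => G z i j) y := fun i j => by
    have h1 : DifferentiableAt ℝ (fun z => (jm * w z) i j) y := by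
      simp only [Matrix.mul_apply]
      fun_prop
    refine h1.congr_of_eventuallyEq ?_
    filter_upwards [hG] with z hz
    rw [hz]
  have hGinv := differentiableAt_matrix_inv hGd hdet.ne'
  have hsq : DifferentiableAt ℝ (fun z => √(G z).det) y := (differentiableAt_det hGd).sqrt hdet.ne'
  set dw : ι → Matrix ι ι ℝ := fun a => Matrix.of fun i j => fderiv ℝ (fun z => w z i j) y (b a)
    with hdw
  have hline : ∀ a, HasDerivAt (fun s : ℝ => y + s • b a) (b a) 0 := fun a => by
    simpa using ((hasDerivAt_id (0 : ℝ)).smul_const (b a)).const_add y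
  have hlift : ∀ (a : ι) {φ : E → ℝ}, DifferentiableAt ℝ φ y →
      HasDerivAt (fun s : ℝ => φ (y + s • b a)) (fderiv ℝ φ y (b a)) 0 := fun a φ hφ => by
    have h1 : HasFDerivAt φ (fderiv ℝ φ y) (y + (0 : ℝ) • b a) := by
      rw [zero_smul, add_zero]
      exact hφ.hasFDerivAt
    exact h1.comp_hasDerivAt 0 (hline a)
  have hdG : ∀ a i j, fderiv ℝ (fun z => G z i j) y (b a) = (jm * dw a) i j := fun a i j => by
    have h1 : (fun z => G z i j) =ᶠ[𝓝 y] fun z => ∑ k, jm i k * w z k j := by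
      filter_upwards [hG] with z hz
      rw [hz, Matrix.mul_apply]
    rw [h1.fderiv_eq, fderiv_fun_sum fun k _ => (hw k j).const_mul _]
    simp only [sum_apply, Matrix.mul_apply]
    refine Finset.sum_congr rfl fun k _ => ?_
    rw [fderiv_const_mul (hw k j)]
    rfl
  have hy0 : ∀ a, y + (0 : ℝ) • b a = y := fun a => by rw [zero_smul, add_zero]
  have hcurve : ∀ a i j, HasDerivAt (fun s : ℝ => G (y + s • b a) i j) ((jm * dw a) i j) 0 :=
    fun a i j => by
      rw [← hdG]
      exact hlift a (hGd i j)
  have hcancel : ∀ a, (G y)⁻¹ * (jm * dw a) = (w y)⁻¹ * dw a := fun a => by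
    rw [hGy, Matrix.mul_inv_rev, Matrix.mul_assoc, ← Matrix.mul_assoc jm⁻¹,
      Matrix.nonsing_inv_mul _ (isUnit_iff_ne_zero.2 hj), Matrix.one_mul]
  have hdsq : ∀ a, fderiv ℝ (fun z => √(G z).det) y (b a) =
      √(G y).det * (1 / 2 * ((w y)⁻¹ * dw a).trace) := fun a => by
    have h1 := hasDerivAt_det (G := fun s : ℝ => G (y + s • b a)) (hcurve a)
      (by rw [hy0]; exact hdet.ne')
    have h2 := h1.sqrt (by simp only [hy0]; exact hdet.ne')
    rw [(hlift a hsq).unique h2, hy0, hcancel]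
    have h3 : √(G y).det * √(G y).det = (G y).det := Real.mul_self_sqrt hdet.le
    have h4 : √(G y).det ≠ 0 := (Real.sqrt_pos.2 hdet).ne'
    field_simp
    rw [sq, h3, mul_comm]
  have hdinv : ∀ a c, fderiv ℝ (fun z => (G z)⁻¹ a c) y (b a) =
      -((w y)⁻¹ * dw a * (G y)⁻¹) a c := fun a c => by
    have h1 := hasDerivAt_matrix_inv (G := fun s : ℝ => G (y + s • b a)) (hcurve a)
      (by rw [hy0]; exact hdet.ne') a c
    rw [(hlift a (hGinv a c)).unique h1, hy0, hcancel]
  have hexp : ∀ a, fderiv ℝ (fun z => √(G z).det * ∑ c, (G z)⁻¹ a c * u z c) y (b a) =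
      √(G y).det * (∑ c, (1 / 2 * ((w y)⁻¹ * dw a).trace * (G y)⁻¹ a c -
        ((w y)⁻¹ * dw a * (G y)⁻¹) a c) * u y c +
        ∑ c, (G y)⁻¹ a c * fderiv ℝ (fun z => u z c) y (b a)) := fun a => by
    have h1 : HasDerivAt (fun s : ℝ => √(G (y + s • b a)).det *
        ∑ c, (G (y + s • b a))⁻¹ a c * u (y + s • b a) c) _ 0 :=
      (hlift a hsq).mul (HasDerivAt.fun_sum (u := Finset.univ) fun c _ =>
        (hlift a (hGinv a c)).mul (hlift a (hu c)))
    have h2 : DifferentiableAt ℝ (fun z => √(G z).det * ∑ c, (G z)⁻¹ a c * u z c) y :=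
      hsq.mul (DifferentiableAt.fun_sum fun c _ => (hGinv a c).mul (hu c))
    rw [(hlift a h2).unique h1]
    simp only [hy0, hdsq, hdinv, Finset.mul_sum, ← Finset.sum_add_distrib]
    exact Finset.sum_congr rfl fun c _ => by ring
  have hinv : (G y)⁻¹ = (w y)⁻¹ * jm⁻¹ := by rw [hGy, Matrix.mul_inv_rev]
  have hWanti : ((w y)⁻¹).transpose = -(w y)⁻¹ := by
    rw [Matrix.transpose_nonsing_inv]
    have h1 : (w y).transpose = -w y := by
      ext i j
      exact hanti y j i
    rw [h1]
    refine Matrix.inv_eq_left_inv ?_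
    rw [neg_mul_neg, Matrix.nonsing_inv_mul _ (isUnit_iff_ne_zero.2 hwdet)]
  have hliou := sum_liouville_eq_zero (dw := dw) hWanti
    (fun a i j => hclosed a i j)
    (fun a i j => by
      simp only [hdw, Matrix.of_apply]
      have h1 : (fun z => w z i j) = fun z => -w z j i := funext fun z => hanti z i j
      rw [h1, fderiv_fun_neg]
      rfl)
  have hdiv : ∀ c, ∑ a, (1 / 2 * ((w y)⁻¹ * dw a).trace * (G y)⁻¹ a c -
      ((w y)⁻¹ * dw a * (G y)⁻¹) a c) = 0 := fun c => by
    have h1 : ∀ a, (1 / 2 * ((w y)⁻¹ * dw a).trace * (G y)⁻¹ a c -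
        ((w y)⁻¹ * dw a * (G y)⁻¹) a c) =
        ∑ k, (1 / 2 * ((w y)⁻¹ * dw a).trace * (w y)⁻¹ a k - ((w y)⁻¹ * dw a * (w y)⁻¹) a k) *
          jm⁻¹ k c := fun a => by
      rw [hinv, ← Matrix.mul_assoc, Matrix.mul_apply, Matrix.mul_apply, Finset.mul_sum,
        ← Finset.sum_sub_distrib]
      exact Finset.sum_congr rfl fun k _ => by ring
    simp only [h1]
    rw [Finset.sum_comm]
    refine Finset.sum_eq_zero fun k _ => ?_
    rw [← Finset.sum_mul, hliou k, zero_mul]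
  simp only [hexp]
  rw [← Finset.mul_sum, Finset.sum_add_distrib, Finset.sum_comm]
  simp only [← Finset.sum_mul, hdiv, zero_mul, Finset.sum_const_zero, zero_add]

end MatrixCalculus

/-! ### Forms and functions in holomorphic charts -/

theorem eventually_mem_overlap {n : ℕ} {M : Type*} [TopologicalSpace M]
    {e e' : OpenPartialHomeomorph M (Cn n)} {y : Cn n}
    (hy : y ∈ e'.target) (hy' : e'.symm y ∈ e.source) :
    ∀ᶠ z in 𝓝 y, z ∈ e'.target ∧ e'.symm z ∈ e.source := by
  have h := (e'.symm.trans e).open_source.mem_nhds (x := y) (by simp [hy, hy'])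
  filter_upwards [h] with z hz
  simpa using hz

section Charts

variable {n : ℕ} {M : Type*} [TopologicalSpace M] [ChartedSpace (Cn n) M]

/-- A complex manifold is a real manifold. -/
instance isManifold_real [IsManifold 𝓘(ℂ, Cn n) ∞ M] : IsManifold 𝓘(ℝ, Cn n) ∞ M := by
  refine isManifold_of_contDiffOn _ _ _ fun e e' he he' => ?_
  have h := (contDiffGroupoid ∞ 𝓘(ℂ, Cn n)).compatible he he'
  rw [contDiffGroupoid, mem_groupoid_of_pregroupoid] at h
  exact h.1.restrict_scalars ℝ

variable (M) in
/-- The value of a form at a point, seen as an alternating form on the model space `ℂⁿ`. -/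
def formAt {k : ℕ} (α : DForm n M k) (x : M) : Cn n [⋀^Fin k]→L[ℝ] ℝ := α x

/-- The real derivative of the inverse of a chart, seen as an endomorphism of `ℂⁿ`. -/
def symmDeriv (e : OpenPartialHomeomorph M (Cn n)) (y : Cn n) : Cn n →L[ℝ] Cn n :=
  mfderiv 𝓘(ℝ, Cn n) 𝓘(ℝ, Cn n) e.symm y

theorem inChart_eq {k : ℕ} (α : DForm n M k) (e : OpenPartialHomeomorph M (Cn n)) (y : Cn n) :
    inChart α e y = (formAt M α (e.symm y)).compContinuousLinearMap (symmDeriv e y) := rfl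

theorem inChart_apply_two (α : DForm n M 2) (e : OpenPartialHomeomorph M (Cn n)) (y v w : Cn n) :
    inChart α e y ![v, w] = formAt M α (e.symm y) ![symmDeriv e y v, symmDeriv e y w] := by
  rw [inChart_eq, ContinuousAlternatingMap.compContinuousLinearMap_apply]
  congr 1
  funext i
  fin_cases i <;> rfl

theorem inChart_add {k : ℕ} (α β : DForm n M k) (e : OpenPartialHomeomorph M (Cn n)) :
    inChart (α + β) e = inChart α e + inChart β e := rfl

theorem inChart_smul {k : ℕ} (c : ℝ) (α : DForm n M k) (e : OpenPartialHomeomorph M (Cn n)) :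
    inChart (c • α) e = c • inChart α e := rfl

theorem IsSmoothForm.contDiffOn_apply {k : ℕ} {α : DForm n M k} (hα : IsSmoothForm α)
    {e : OpenPartialHomeomorph M (Cn n)} (he : e ∈ atlas (Cn n) M) (v : Fin k → Cn n) :
    ContDiffOn ℝ ∞ (fun y => inChart α e y v) e.target :=
  (ContinuousAlternatingMap.apply ℝ (Cn n) ℝ v).contDiff.comp_contDiffOn (hα e he)

theorem IsSmoothForm.differentiableAt {k : ℕ} {α : DForm n M k} (hα : IsSmoothForm α)
    {e : OpenPartialHomeomorph M (Cn n)} (he : e ∈ atlas (Cn n) M) {y : Cn n}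
    (hy : y ∈ e.target) : DifferentiableAt ℝ (inChart α e) y :=
  ((hα e he).differentiableOn (by simp)).differentiableAt (e.open_target.mem_nhds hy)

theorem IsSmoothForm.add_smul {k : ℕ} {α β : DForm n M k} (hα : IsSmoothForm α)
    (hβ : IsSmoothForm β) (t : ℝ) : IsSmoothForm (α + t • β) := fun e he =>
  (hα e he).add ((hβ e he).const_smul t)

theorem IsOneOne.add_smul {α β : DForm n M 2} (hα : IsOneOne α) (hβ : IsOneOne β) (t : ℝ) :
    IsOneOne (α + t • β) := fun x v w =>
  congrArg₂ (fun a b : ℝ => a + t * b) (hα x v w) (hβ x v w)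

variable [IsManifold 𝓘(ℂ, Cn n) ∞ M]

/-- Tangent vectors at a point are written in the preferred chart at that point, so the derivative
of `e⁻¹` is that of a transition map. -/
theorem symmDeriv_eq_fderiv {e : OpenPartialHomeomorph M (Cn n)} (he : e ∈ atlas (Cn n) M)
    {y : Cn n} (hy : y ∈ e.target) :
    symmDeriv e y = fderiv ℝ (chartAt (Cn n) (e.symm y) ∘ e.symm) y := by
  have h : MDifferentiableAt 𝓘(ℝ, Cn n) 𝓘(ℝ, Cn n) e.symm y := mdifferentiableAt_atlas_symm he hy
  unfold symmDeriv
  rw [h.mfderiv]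
  simp [writtenInExtChartAt]
  rfl

/-- The inverse of a chart is holomorphic: its derivative commutes with the multiplication
by `i`. -/
theorem symmDeriv_I_smul {e : OpenPartialHomeomorph M (Cn n)} (he : e ∈ atlas (Cn n) M)
    {y : Cn n} (hy : y ∈ e.target) (v : Cn n) :
    symmDeriv e y (Complex.I • v) = Complex.I • symmDeriv e y v := by
  rw [symmDeriv_eq_fderiv he hy]
  have h := (contDiffGroupoid ∞ 𝓘(ℂ, Cn n)).compatible he
    (chart_mem_atlas (Cn n) (e.symm y))
  rw [contDiffGroupoid, mem_groupoid_of_pregroupoid] at h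
  have h1 : ContDiffOn ℂ ∞ (chartAt (Cn n) (e.symm y) ∘ e.symm)
      (e.symm ≫ₕ chartAt (Cn n) (e.symm y)).source := by simpa [contDiffPregroupoid] using! h.1
  have h2 : y ∈ (e.symm ≫ₕ chartAt (Cn n) (e.symm y)).source := by
    simp [hy]
  have h3 : DifferentiableAt ℂ (chartAt (Cn n) (e.symm y) ∘ e.symm) y :=
    (h1.differentiableOn (by simp)).differentiableAt
      ((e.symm ≫ₕ chartAt (Cn n) (e.symm y)).open_source.mem_nhds h2)
  rw [h3.fderiv_restrictScalars ℝ]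
  simp

theorem contDiffAt_transition {e e' : OpenPartialHomeomorph M (Cn n)} (he : e ∈ atlas (Cn n) M)
    (he' : e' ∈ atlas (Cn n) M) {y : Cn n} (hy : y ∈ e'.target) (hy' : e'.symm y ∈ e.source) :
    ContDiffAt ℝ ∞ (e ∘ e'.symm) y := by
  have h1 : ContMDiffAt 𝓘(ℝ, Cn n) 𝓘(ℝ, Cn n) ∞ e (e'.symm y) :=
    contMDiffAt_of_mem_maximalAtlas (IsManifold.subset_maximalAtlas he) hy'
  have h2 : ContMDiffAt 𝓘(ℝ, Cn n) 𝓘(ℝ, Cn n) ∞ e'.symm y :=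
    contMDiffAt_symm_of_mem_maximalAtlas (IsManifold.subset_maximalAtlas he') hy
  exact contMDiffAt_iff_contDiffAt.1 (h1.comp y h2)

/-- The chain rule for `e'⁻¹ = e⁻¹ ∘ (e ∘ e'⁻¹)`. -/
theorem symmDeriv_transition {e e' : OpenPartialHomeomorph M (Cn n)} (he : e ∈ atlas (Cn n) M)
    (he' : e' ∈ atlas (Cn n) M) {y : Cn n} (hy : y ∈ e'.target) (hy' : e'.symm y ∈ e.source) :
    symmDeriv e' y = (symmDeriv e (e (e'.symm y))).comp (fderiv ℝ (e ∘ e'.symm) y) := by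
  have h1 : MDifferentiableAt 𝓘(ℝ, Cn n) 𝓘(ℝ, Cn n) e.symm ((e ∘ e'.symm) y) :=
    mdifferentiableAt_atlas_symm he (e.map_source hy')
  have h2 : MDifferentiableAt 𝓘(ℝ, Cn n) 𝓘(ℝ, Cn n) (e ∘ e'.symm) y :=
    ((contDiffAt_transition he he' hy hy').differentiableAt (by simp)).mdifferentiableAt
  have h3 := mfderiv_comp y h1 h2
  have h4 : (e.symm ∘ (e ∘ e'.symm)) =ᶠ[𝓝 y] e'.symm := by
    filter_upwards [eventually_mem_overlap hy hy'] with z hz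
    exact e.left_inv hz.2
  rw [h4.mfderiv_eq, mfderiv_eq_fderiv] at h3
  exact h3

/-- The tangent space at `x` is identified with `ℂⁿ` through the preferred chart at `x`, so the
derivative of that chart is the identity. -/
theorem symmDeriv_chartAt (x : M) :
    symmDeriv (chartAt (Cn n) x) (chartAt (Cn n) x x) = ContinuousLinearMap.id ℝ (Cn n) := by
  have h := mem_chart_source (Cn n) x
  rw [symmDeriv_eq_fderiv (chart_mem_atlas _ _) ((chartAt (Cn n) x).map_source h),
    (chartAt (Cn n) x).left_inv h]
  have h4 : (chartAt (Cn n) x ∘ (chartAt (Cn n) x).symm) =ᶠ[𝓝 (chartAt (Cn n) x x)] id := by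
    filter_upwards [(chartAt (Cn n) x).open_target.mem_nhds ((chartAt (Cn n) x).map_source h)]
      with z hz
    exact (chartAt (Cn n) x).right_inv hz
  rw [h4.fderiv_eq, fderiv_id]

theorem mfderiv_chartAt_self (x : M) :
    mfderiv 𝓘(ℝ, Cn n) 𝓘(ℝ, Cn n) (chartAt (Cn n) x) x = ContinuousLinearMap.id ℝ (Cn n) := by
  have h := mfderiv_extChartAt_self (I := 𝓘(ℝ, Cn n)) (x := x)
  simpa using! h

theorem symmDeriv_comp_fderiv_transition {e : OpenPartialHomeomorph M (Cn n)}
    (he : e ∈ atlas (Cn n) M) {x : M} (hx : x ∈ e.source) :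
    (symmDeriv e (e x)).comp
      (fderiv ℝ (e ∘ (chartAt (Cn n) x).symm) (chartAt (Cn n) x x)) =
        ContinuousLinearMap.id ℝ (Cn n) := by
  have h := mem_chart_source (Cn n) x
  have h1 := symmDeriv_transition he (chart_mem_atlas (Cn n) x)
    ((chartAt (Cn n) x).map_source h) (by rwa [(chartAt (Cn n) x).left_inv h])
  rw [symmDeriv_chartAt, (chartAt (Cn n) x).left_inv h] at h1
  exact h1.symm

theorem fderiv_transition_comp_symmDeriv {e : OpenPartialHomeomorph M (Cn n)}
    (he : e ∈ atlas (Cn n) M) {x : M} (hx : x ∈ e.source) :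
    (fderiv ℝ (e ∘ (chartAt (Cn n) x).symm) (chartAt (Cn n) x x)).comp (symmDeriv e (e x)) =
        ContinuousLinearMap.id ℝ (Cn n) := by
  have h := symmDeriv_comp_fderiv_transition he hx
  have h1 := congrArg ContinuousLinearMap.toLinearMap h
  have h2 := (LinearMap.comp_eq_id_comm ℝ (Cn n)).1 h1
  exact ContinuousLinearMap.coe_injective h2

theorem symmDeriv_bijective {e : OpenPartialHomeomorph M (Cn n)}
    (he : e ∈ atlas (Cn n) M) {y : Cn n} (hy : y ∈ e.target) :
    Function.Bijective (symmDeriv e y) := by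
  have h1 := symmDeriv_comp_fderiv_transition he (e.map_target hy)
  have h2 := fderiv_transition_comp_symmDeriv he (e.map_target hy)
  rw [e.right_inv hy] at h1 h2
  exact Function.bijective_iff_has_inverse.2 ⟨_, fun v => DFunLike.congr_fun h2 v,
    fun v => DFunLike.congr_fun h1 v⟩

end Charts

section Forms

variable {n : ℕ} {M : Type*} [TopologicalSpace M] [ChartedSpace (Cn n) M]
  [IsManifold 𝓘(ℂ, Cn n) ∞ M]

theorem inChart_chartAt_self {k : ℕ} (α : DForm n M k) (x : M) :
    inChart α (chartAt (Cn n) x) (chartAt (Cn n) x x) = formAt M α x := by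
  rw [inChart_eq, symmDeriv_chartAt, (chartAt (Cn n) x).left_inv (mem_chart_source _ x)]
  rfl

/-- Coordinate expressions in two charts differ by the pullback under the transition map. -/
theorem inChart_transition {k : ℕ} (α : DForm n M k) {e e' : OpenPartialHomeomorph M (Cn n)}
    (he : e ∈ atlas (Cn n) M) (he' : e' ∈ atlas (Cn n) M) {y : Cn n} (hy : y ∈ e'.target)
    (hy' : e'.symm y ∈ e.source) :
    inChart α e' y = (inChart α e ((e ∘ e'.symm) y)).compContinuousLinearMap
      (fderiv ℝ (e ∘ e'.symm) y) := by
  rw [inChart_eq, inChart_eq, symmDeriv_transition he he' hy hy']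
  simp only [Function.comp_apply]
  rw [e.left_inv hy']
  rfl

theorem formAt_extD {k : ℕ} (α : DForm n M k) (x : M) :
    formAt M (extD α) x = extDeriv (inChart α (chartAt (Cn n) x)) (chartAt (Cn n) x x) := by
  have h : formAt M (extD α) x =
    (extDeriv (inChart α (chartAt (Cn n) x)) (chartAt (Cn n) x x)).compContinuousLinearMap
      (mfderiv 𝓘(ℝ, Cn n) 𝓘(ℝ, Cn n) (chartAt (Cn n) x) x) := rfl
  rw [h, mfderiv_chartAt_self]
  rfl

/-- The exterior derivative does not depend on the chart used to compute it. -/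
theorem inChart_extD {k : ℕ} (α : DForm n M k) {e : OpenPartialHomeomorph M (Cn n)}
    (he : e ∈ atlas (Cn n) M) {y : Cn n} (hy : y ∈ e.target)
    (hα : DifferentiableAt ℝ (inChart α e) y) :
    inChart (extD α) e y = extDeriv (inChart α e) y := by
  obtain ⟨x, hx, rfl⟩ : ∃ x ∈ e.source, e x = y := ⟨_, e.map_target hy, e.right_inv hy⟩
  have hs := mem_chart_source (Cn n) x
  have hl := (chartAt (Cn n) x).left_inv hs
  have ht := (chartAt (Cn n) x).map_source hs
  have h1 : inChart α (chartAt (Cn n) x) =ᶠ[𝓝 (chartAt (Cn n) x x)] fun z =>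
      (inChart α e ((e ∘ (chartAt (Cn n) x).symm) z)).compContinuousLinearMap
        (fderiv ℝ (e ∘ (chartAt (Cn n) x).symm) z) := by
    filter_upwards [eventually_mem_overlap (e := e) ht (by rwa [hl])] with z hz
    exact inChart_transition α he (chart_mem_atlas _ _) hz.1 hz.2
  have h2 : (e ∘ (chartAt (Cn n) x).symm) (chartAt (Cn n) x x) = e x := by
    rw [Function.comp_apply, hl]
  rw [inChart_eq, e.left_inv hx, formAt_extD, h1.extDeriv_eq,
    extDeriv_pullback (r := ∞) (by rwa [h2])
      (contDiffAt_transition he (chart_mem_atlas _ _) ht (by rwa [hl]))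
      (by rw [minSmoothness_of_isRCLikeNormedField]; exact ENat.LEInfty.out), h2]
  ext v
  simp only [ContinuousAlternatingMap.compContinuousLinearMap_apply]
  congr 1
  funext i
  exact DFunLike.congr_fun (fderiv_transition_comp_symmDeriv he hx) (v i)

theorem IsOneOne.inChart {α : DForm n M 2} (hα : IsOneOne α)
    {e : OpenPartialHomeomorph M (Cn n)} (he : e ∈ atlas (Cn n) M) {y : Cn n}
    (hy : y ∈ e.target) (v w : Cn n) :
    inChart α e y ![Complex.I • v, Complex.I • w] = inChart α e y ![v, w] := by
  rw [inChart_apply_two, inChart_apply_two, symmDeriv_I_smul he hy, symmDeriv_I_smul he hy]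
  exact hα _ _ _

theorem metricOf_symmDeriv (α : DForm n M 2)
    {e : OpenPartialHomeomorph M (Cn n)} (he : e ∈ atlas (Cn n) M) {y : Cn n}
    (hy : y ∈ e.target) (v w : Cn n) :
    metricOf α (e.symm y) (symmDeriv e y v) (symmDeriv e y w) =
      inChart α e y ![v, Complex.I • w] := by
  rw [inChart_apply_two, symmDeriv_I_smul he hy]
  rfl

theorem extD_add_smul {k : ℕ} {α β : DForm n M k} (hα : IsSmoothForm α) (hβ : IsSmoothForm β)
    (t : ℝ) : extD (α + t • β) = extD α + t • extD β := by
  funext x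
  have hx := (chartAt (Cn n) x).map_source (mem_chart_source (Cn n) x)
  have h1 := hα.differentiableAt (chart_mem_atlas _ x) hx
  have h2 := hβ.differentiableAt (chart_mem_atlas _ x) hx
  have h3 : formAt M (extD (α + t • β)) x = formAt M (extD α) x + t • formAt M (extD β) x := by
    rw [formAt_extD, formAt_extD, formAt_extD, inChart_add, inChart_smul,
      extDeriv_add h1 (h2.const_smul t), extDeriv_smul]
  exact h3

theorem IsClosedOneOne.add_smul {α β : DForm n M 2} (hα : IsClosedOneOne α)
    (hβ : IsClosedOneOne β) (t : ℝ) : IsClosedOneOne (α + t • β) := by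
  refine ⟨hα.1.add_smul hβ.1 t, hα.2.1.add_smul hβ.2.1 t, ?_⟩
  rw [extD_add_smul hα.1 hβ.1, hα.2.2, hβ.2.2, smul_zero, add_zero]

end Forms

section Functions

variable {n : ℕ} {M : Type*} [TopologicalSpace M] [ChartedSpace (Cn n) M]
  [IsManifold 𝓘(ℂ, Cn n) ∞ M]

theorem contDiffOn_comp_symm {f : M → ℝ} (hf : ContMDiff 𝓘(ℝ, Cn n) 𝓘(ℝ, ℝ) ∞ f)
    {e : OpenPartialHomeomorph M (Cn n)} (he : e ∈ atlas (Cn n) M) :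
    ContDiffOn ℝ ∞ (f ∘ e.symm) e.target := by
  rw [← contMDiffOn_iff_contDiffOn]
  exact hf.comp_contMDiffOn
    (contMDiffOn_symm_of_mem_maximalAtlas (IsManifold.subset_maximalAtlas he))

theorem dAt_symmDeriv {f : M → ℝ} (hf : ContMDiff 𝓘(ℝ, Cn n) 𝓘(ℝ, ℝ) ∞ f)
    {e : OpenPartialHomeomorph M (Cn n)} (he : e ∈ atlas (Cn n) M) {y : Cn n}
    (hy : y ∈ e.target) (v : Cn n) :
    dAt n f (e.symm y) (symmDeriv e y v) = fderiv ℝ (f ∘ e.symm) y v := by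
  have h1 : MDifferentiableAt 𝓘(ℝ, Cn n) 𝓘(ℝ, Cn n) e.symm y := mdifferentiableAt_atlas_symm he hy
  have h2 := mfderiv_comp y ((hf.mdifferentiable (by simp)) (e.symm y)) h1
  rw [mfderiv_eq_fderiv] at h2
  rw [h2]
  rfl

theorem inChart_dFun {f : M → ℝ} (hf : ContMDiff 𝓘(ℝ, Cn n) 𝓘(ℝ, ℝ) ∞ f)
    {e : OpenPartialHomeomorph M (Cn n)} (he : e ∈ atlas (Cn n) M) {y : Cn n}
    (hy : y ∈ e.target) (v : Fin 1 → Cn n) :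
    inChart (dFun n f) e y v = fderiv ℝ (f ∘ e.symm) y (v 0) :=
  dAt_symmDeriv hf he hy (v 0)

theorem inChart_dcFun {f : M → ℝ} (hf : ContMDiff 𝓘(ℝ, Cn n) 𝓘(ℝ, ℝ) ∞ f)
    {e : OpenPartialHomeomorph M (Cn n)} (he : e ∈ atlas (Cn n) M) {y : Cn n}
    (hy : y ∈ e.target) (v : Fin 1 → Cn n) :
    inChart (dcFun n f) e y v = -fderiv ℝ (f ∘ e.symm) y (Complex.I • v 0) := by
  rw [← dAt_symmDeriv hf he hy, symmDeriv_I_smul he hy]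
  rfl

theorem isSmoothForm_dcFun {f : M → ℝ} (hf : ContMDiff 𝓘(ℝ, Cn n) 𝓘(ℝ, ℝ) ∞ f) :
    IsSmoothForm (dcFun n f) := by
  intro e he
  have h1 : ContDiffOn ℝ ∞ (fderiv ℝ (f ∘ e.symm)) e.target :=
    (contDiffOn_comp_symm hf he).fderiv_of_isOpen e.open_target (by simp)
  have h2 : ContDiffOn ℝ ∞ (fun y =>
      ContinuousAlternatingMap.ofSubsingletonLIE (𝕜 := ℝ) (E := Cn n) (F := ℝ) (0 : Fin 1)
      (-(fderiv ℝ (f ∘ e.symm) y).comp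
        ((Complex.I • ContinuousLinearMap.id ℂ (Cn n)).restrictScalars ℝ))) e.target :=
    (ContinuousAlternatingMap.ofSubsingletonLIE (𝕜 := ℝ) (E := Cn n) (F := ℝ)
      (0 : Fin 1)).contDiff.comp_contDiffOn (h1.clm_comp contDiffOn_const).neg
  refine h2.congr fun y hy => ?_
  ext v
  rw [inChart_dcFun hf he hy]
  rfl

/-- In a chart, `dd^c f (v, w) = D²f (w, i v) - D²f (v, i w)`. -/
theorem inChart_ddc {f : M → ℝ} (hf : ContMDiff 𝓘(ℝ, Cn n) 𝓘(ℝ, ℝ) ∞ f)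
    {e : OpenPartialHomeomorph M (Cn n)} (he : e ∈ atlas (Cn n) M) {y : Cn n}
    (hy : y ∈ e.target) (v w : Cn n) :
    inChart (ddc n f) e y ![v, w] =
      fderiv ℝ (fderiv ℝ (f ∘ e.symm)) y w (Complex.I • v) -
        fderiv ℝ (fderiv ℝ (f ∘ e.symm)) y v (Complex.I • w) := by
  have h1 := (isSmoothForm_dcFun hf).differentiableAt he hy
  have h2 : DifferentiableAt ℝ (fderiv ℝ (f ∘ e.symm)) y :=
    (((contDiffOn_comp_symm hf he).fderiv_of_isOpen e.open_target
      (m := ∞) (by simp)).differentiableOn (by simp)).differentiableAt (e.open_target.mem_nhds hy)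
  have h3 : ∀ (u : Fin 1 → Cn n) (a : Cn n), fderiv ℝ (fun z => inChart (dcFun n f) e z u) y a =
      -fderiv ℝ (fderiv ℝ (f ∘ e.symm)) y a (Complex.I • u 0) := fun u a => by
    have h4 : (fun z => inChart (dcFun n f) e z u) =ᶠ[𝓝 y]
        fun z => -fderiv ℝ (f ∘ e.symm) z (Complex.I • u 0) := by
      filter_upwards [e.open_target.mem_nhds hy] with z hz
      exact inChart_dcFun hf he hz u
    rw [h4.fderiv_eq, fderiv_fun_neg, fderiv_clm_apply h2 (differentiableAt_const _)]
    simp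
  unfold ddc
  rw [inChart_extD _ he hy h1, extDeriv_apply h1, Fin.sum_univ_two]
  simp only [h3]
  simp [Fin.removeNth]
  ring

end Functions

/-! ### Linear algebra of (1,1)-forms -/

section LinearAlgebra

variable {n : ℕ}

variable (n) in
/-- The real basis `∂/∂x_j, ∂/∂y_j` of `ℂⁿ`. -/
def stdBasis : Module.Basis (Fin n × Fin 2) ℝ (Cn n) :=
  (Pi.basis fun _ : Fin n => Complex.basisOneI).reindex (Equiv.sigmaEquivProd (Fin n) (Fin 2))

theorem stdBasis_apply (a : Fin n × Fin 2) : stdBasis n a = basisVec a := by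
  obtain ⟨j, k⟩ := a
  rw [stdBasis, Module.Basis.reindex_apply, Equiv.sigmaEquivProd_symm_apply, Pi.basis_apply,
    Complex.coe_basisOneI, basisVec]
  fin_cases k <;> rfl

variable (n) in
/-- The multiplication by `i` on `ℂⁿ`. -/
def mulI : Cn n →ₗ[ℝ] Cn n :=
  (Complex.I • LinearMap.id : Cn n →ₗ[ℂ] Cn n).restrictScalars ℝ

theorem mulI_apply (v : Cn n) : mulI n v = Complex.I • v := rfl

variable (n) in
/-- The matrix of the complex structure in the real basis of `ℂⁿ`. -/
def matI : Matrix (Fin n × Fin 2) (Fin n × Fin 2) ℝ :=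
  LinearMap.toMatrix (stdBasis n) (stdBasis n) (mulI n)

theorem matI_mul_matI : matI n * matI n = -1 := by
  have h : mulI n ∘ₗ mulI n = -LinearMap.id := by
    refine LinearMap.ext fun v => ?_
    rw [LinearMap.comp_apply, mulI_apply, mulI_apply, smul_smul, Complex.I_mul_I]
    simp
  rw [matI, ← LinearMap.toMatrix_comp, h, map_neg, LinearMap.toMatrix_id]

theorem matI_transpose_mul_transpose : (matI n).transpose * (matI n).transpose = -1 := by
  rw [← Matrix.transpose_mul, matI_mul_matI, Matrix.transpose_neg, Matrix.transpose_one]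

theorem det_matI_ne_zero : (matI n).det ≠ 0 := fun h => by
  have h1 := congrArg Matrix.det (matI_mul_matI (n := n))
  rw [Matrix.det_mul, h, zero_mul, Matrix.det_neg, Matrix.det_one, mul_one] at h1
  exact pow_ne_zero _ (by norm_num) h1.symm

theorem form_swap (β : Cn n [⋀^Fin 2]→L[ℝ] ℝ) (v w : Cn n) : β ![v, w] = -β ![w, v] := by
  have h := β.toAlternatingMap.map_swap ![w, v] (i := 0) (j := 1) (by decide)
  have e : (![w, v] ∘ Equiv.swap (0 : Fin 2) 1 : Fin 2 → Cn n) = ![v, w] := by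
    funext i
    fin_cases i <;> rfl
  rw [e] at h
  exact h

/-- An alternating 2-form as a bilinear form. -/
def bilinOf (β : Cn n [⋀^Fin 2]→L[ℝ] ℝ) : LinearMap.BilinForm ℝ (Cn n) :=
  LinearMap.mk₂ ℝ (fun v w => β ![v, w])
    (fun v v' w => β.toAlternatingMap.map_vecCons_add ![w] v v')
    (fun c v w => β.toAlternatingMap.map_vecCons_smul ![w] c v)
    (fun v w w' => by
      rw [form_swap, form_swap β v w, form_swap β v w']
      have h := β.toAlternatingMap.map_vecCons_add ![v] w w'
      exact (congrArg Neg.neg h).trans (neg_add _ _))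
    (fun c v w => by
      rw [form_swap, form_swap β v w]
      have h := β.toAlternatingMap.map_vecCons_smul ![v] c w
      exact (congrArg Neg.neg h).trans (smul_neg _ _).symm)

theorem bilinOf_apply (β : Cn n [⋀^Fin 2]→L[ℝ] ℝ) (v w : Cn n) : bilinOf β v w = β ![v, w] := rfl

/-- The matrix `β_{ab} = β(e_a, e_b)` of a 2-form. -/
def formMat (β : Cn n [⋀^Fin 2]→L[ℝ] ℝ) : Matrix (Fin n × Fin 2) (Fin n × Fin 2) ℝ :=
  Matrix.of fun a b => β ![basisVec a, basisVec b]

theorem formMat_eq (β : Cn n [⋀^Fin 2]→L[ℝ] ℝ) :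
    formMat β = LinearMap.BilinForm.toMatrix (stdBasis n) (bilinOf β) := by
  ext a b
  rw [LinearMap.BilinForm.toMatrix_apply, stdBasis_apply, stdBasis_apply]
  rfl

theorem formMat_transpose (β : Cn n [⋀^Fin 2]→L[ℝ] ℝ) : (formMat β).transpose = -formMat β := by
  ext a b
  exact form_swap β _ _

/-- The matrix `β(e_a, i e_b)` of the bilinear form that the complex structure associates with
a 2-form. -/
def symMat (β : Cn n [⋀^Fin 2]→L[ℝ] ℝ) : Matrix (Fin n × Fin 2) (Fin n × Fin 2) ℝ :=
  Matrix.of fun a b => β ![basisVec a, Complex.I • basisVec b]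

theorem symMat_eq (β : Cn n [⋀^Fin 2]→L[ℝ] ℝ) : symMat β = formMat β * matI n := by
  rw [formMat_eq, matI, ← LinearMap.BilinForm.toMatrix_compRight]
  ext a b
  rw [LinearMap.BilinForm.toMatrix_apply, stdBasis_apply, stdBasis_apply]
  rfl

theorem formMat_eq_symMat (β : Cn n [⋀^Fin 2]→L[ℝ] ℝ) : formMat β = -(symMat β * matI n) := by
  rw [symMat_eq, Matrix.mul_assoc, matI_mul_matI, Matrix.mul_neg, Matrix.mul_one, neg_neg]

/-- A 2-form on `ℂⁿ` is of type `(1,1)` iff it is invariant under the multiplication by `i`. -/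
def IsInvariant (β : Cn n [⋀^Fin 2]→L[ℝ] ℝ) : Prop :=
  ∀ v w : Cn n, β ![Complex.I • v, Complex.I • w] = β ![v, w]

variable {β : Cn n [⋀^Fin 2]→L[ℝ] ℝ}

theorem IsInvariant.transpose_mul_formMat_mul (hβ : IsInvariant β) :
    (matI n).transpose * formMat β * matI n = formMat β := by
  rw [formMat_eq, matI, ← LinearMap.BilinForm.toMatrix_comp]
  exact congrArg _ (LinearMap.ext₂ fun v w => hβ v w)

theorem IsInvariant.symMat_eq (hβ : IsInvariant β) :
    symMat β = -(matI n).transpose * formMat β := by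
  have h := congrArg ((matI n).transpose * ·) hβ.transpose_mul_formMat_mul
  simp only [← Matrix.mul_assoc, matI_transpose_mul_transpose] at h
  rw [KahlerDeformation.symMat_eq, Matrix.neg_mul, ← h]
  simp

theorem IsInvariant.transpose_symMat (hβ : IsInvariant β) : (symMat β).transpose = symMat β := by
  rw [KahlerDeformation.symMat_eq, Matrix.transpose_mul, formMat_transpose, Matrix.mul_neg,
    ← Matrix.neg_mul, ← hβ.symMat_eq, KahlerDeformation.symMat_eq]

theorem IsInvariant.transpose_mul_symMat_mul (hβ : IsInvariant β) :
    (matI n).transpose * symMat β * matI n = symMat β := by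
  rw [KahlerDeformation.symMat_eq, ← Matrix.mul_assoc, hβ.transpose_mul_formMat_mul]

theorem IsInvariant.mul_inv_symMat_mul (hβ : IsInvariant β) :
    matI n * (symMat β)⁻¹ * (matI n).transpose = (symMat β)⁻¹ := by
  have hu : IsUnit (matI n).det := isUnit_iff_ne_zero.2 det_matI_ne_zero
  have hu' : IsUnit (matI n).transpose.det := by rwa [Matrix.det_transpose]
  have h := congrArg (fun A => matI n * A * (matI n).transpose)
    (congrArg Inv.inv hβ.transpose_mul_symMat_mul)
  simp only [Matrix.mul_inv_rev] at h
  rw [← h, Matrix.mul_assoc, Matrix.mul_assoc, Matrix.mul_assoc, Matrix.nonsing_inv_mul _ hu',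
    Matrix.mul_one, ← Matrix.mul_assoc, Matrix.mul_nonsing_inv _ hu, Matrix.one_mul]

/-- The inner product of two 2-forms, in terms of the inverse `K` of the Gram matrix of the
metric. -/
def innerMat (K : Matrix (Fin n × Fin 2) (Fin n × Fin 2) ℝ) (β γ : Cn n [⋀^Fin 2]→L[ℝ] ℝ) : ℝ :=
  1 / 2 * (K.transpose * formMat β * K * (formMat γ).transpose).trace

/-- The inner product of 2-forms in terms of the associated bilinear forms:
`⟨β, γ⟩ = ½ tr (g⁻¹ s_β g⁻¹ s_γ)`. -/
theorem innerMat_eq_trace_symMat {Ω γ : Cn n [⋀^Fin 2]→L[ℝ] ℝ} (hΩ : IsInvariant Ω)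
    (hγ : IsInvariant γ) (β : Cn n [⋀^Fin 2]→L[ℝ] ℝ) :
    innerMat (symMat Ω)⁻¹ β γ =
      1 / 2 * ((symMat Ω)⁻¹ * symMat β * (symMat Ω)⁻¹ * symMat γ).trace := by
  rw [innerMat, Matrix.transpose_nonsing_inv, hΩ.transpose_symMat, formMat_eq_symMat β,
    formMat_eq_symMat γ, Matrix.transpose_neg, Matrix.transpose_mul, hγ.transpose_symMat]
  have h : (symMat Ω)⁻¹ * -(symMat β * matI n) * (symMat Ω)⁻¹ *
      -((matI n).transpose * symMat γ) = (symMat Ω)⁻¹ * symMat β *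
        (matI n * (symMat Ω)⁻¹ * (matI n).transpose) * symMat γ := by
    simp only [Matrix.mul_neg, Matrix.neg_mul, neg_neg, Matrix.mul_assoc]
  rw [h, hΩ.mul_inv_symMat_mul]

/-- If the symmetric part of `β` is `h + Jᵀ h J`, as for `β = dd^c f` and the Hessian `h` of `f`,
then both summands contribute equally to the inner product with a `(1,1)`-form. -/
theorem innerMat_eq_trace_of_symMat_eq {Ω γ β : Cn n [⋀^Fin 2]→L[ℝ] ℝ} (hΩ : IsInvariant Ω)
    (hγ : IsInvariant γ) {h : Matrix (Fin n × Fin 2) (Fin n × Fin 2) ℝ}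
    (hβ : symMat β = h + (matI n).transpose * h * matI n) :
    innerMat (symMat Ω)⁻¹ β γ = ((symMat Ω)⁻¹ * symMat γ * (symMat Ω)⁻¹ * h).trace := by
  rw [innerMat_eq_trace_symMat hΩ hγ, hβ]
  set K := (symMat Ω)⁻¹ with hK
  have hK' : matI n * K * (matI n).transpose = K := hΩ.mul_inv_symMat_mul
  have h1 : K * (matI n).transpose = -(matI n * K) := by
    have := congrArg (matI n * ·) hK'
    simp only [← Matrix.mul_assoc, matI_mul_matI] at this
    rw [← this]
    simp
  have h2 : matI n * K = -(K * (matI n).transpose) := by rw [h1, neg_neg]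
  have h3 : (K * ((matI n).transpose * h * matI n) * K * symMat γ).trace =
      (K * h * K * symMat γ).trace := by
    have e1 : K * ((matI n).transpose * h * matI n) * K * symMat γ =
        (K * (matI n).transpose) * h * (matI n * K) * symMat γ := by
      simp only [Matrix.mul_assoc]
    rw [e1, h1, h2]
    have e2 : -(-(K * (matI n).transpose)) * h * -(K * (matI n).transpose) * symMat γ =
        matI n * (K * h * K * (matI n).transpose * symMat γ) := by
      rw [h1]
      simp only [Matrix.neg_mul, neg_neg, Matrix.mul_assoc]
      rw [← Matrix.mul_assoc K (matI n).transpose, h1]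
      simp only [Matrix.mul_neg, Matrix.neg_mul, Matrix.mul_assoc]
    rw [e2, Matrix.trace_mul_comm]
    have e3 : K * h * K * (matI n).transpose * symMat γ * matI n =
        K * h * K * ((matI n).transpose * symMat γ * matI n) := by
      simp only [Matrix.mul_assoc]
    rw [e3, hγ.transpose_mul_symMat_mul]
  have h4 : (K * symMat γ * K * h).trace = (K * h * K * symMat γ).trace := by
    rw [Matrix.mul_assoc (K * symMat γ), Matrix.trace_mul_comm, Matrix.mul_assoc,
      Matrix.mul_assoc, Matrix.mul_assoc]
  rw [Matrix.mul_add, Matrix.add_mul, Matrix.add_mul, Matrix.trace_add, h3, h4]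
  ring

theorem formMat_comp (β : Cn n [⋀^Fin 2]→L[ℝ] ℝ) (L : Cn n →L[ℝ] Cn n) :
    formMat (β.compContinuousLinearMap L) =
      (LinearMap.toMatrix (stdBasis n) (stdBasis n) L.toLinearMap).transpose * formMat β *
        LinearMap.toMatrix (stdBasis n) (stdBasis n) L.toLinearMap := by
  rw [formMat_eq, formMat_eq, ← LinearMap.BilinForm.toMatrix_comp]
  refine congrArg _ (LinearMap.ext₂ fun v w => ?_)
  rw [LinearMap.BilinForm.comp_apply, bilinOf_apply, bilinOf_apply,
    ContinuousAlternatingMap.compContinuousLinearMap_apply]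
  congr 1
  funext i
  fin_cases i <;> rfl

theorem symMat_comp (β : Cn n [⋀^Fin 2]→L[ℝ] ℝ) (L : Cn n →L[ℝ] Cn n)
    (hL : ∀ v, L (Complex.I • v) = Complex.I • L v) :
    symMat (β.compContinuousLinearMap L) =
      (LinearMap.toMatrix (stdBasis n) (stdBasis n) L.toLinearMap).transpose * symMat β *
        LinearMap.toMatrix (stdBasis n) (stdBasis n) L.toLinearMap := by
  have h : L.toLinearMap ∘ₗ mulI n = mulI n ∘ₗ L.toLinearMap := LinearMap.ext hL
  rw [symMat_eq, symMat_eq, formMat_comp, Matrix.mul_assoc, matI, ← LinearMap.toMatrix_comp, h,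
    LinearMap.toMatrix_comp (stdBasis n) (stdBasis n) (stdBasis n)]
  simp only [Matrix.mul_assoc]

theorem isUnit_det_toMatrix {L : Cn n →L[ℝ] Cn n} (hL : Function.Bijective L) :
    IsUnit (LinearMap.toMatrix (stdBasis n) (stdBasis n) L.toLinearMap).det := by
  have h1 : IsUnit (LinearEquiv.ofBijective L.toLinearMap hL).toLinearMap.det :=
    LinearEquiv.isUnit_det' _
  rw [LinearMap.det_toMatrix]
  exact h1

/-- The inner product of 2-forms does not depend on the basis. -/
theorem innerMat_comp {G : Matrix (Fin n × Fin 2) (Fin n × Fin 2) ℝ}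
    (L : Cn n →L[ℝ] Cn n) (hL : Function.Bijective L) (β γ : Cn n [⋀^Fin 2]→L[ℝ] ℝ) :
    innerMat ((LinearMap.toMatrix (stdBasis n) (stdBasis n) L.toLinearMap).transpose * G *
      LinearMap.toMatrix (stdBasis n) (stdBasis n) L.toLinearMap)⁻¹
      (β.compContinuousLinearMap L) (γ.compContinuousLinearMap L) = innerMat G⁻¹ β γ := by
  set P := LinearMap.toMatrix (stdBasis n) (stdBasis n) L.toLinearMap with hP
  have hPu : IsUnit P.det := isUnit_det_toMatrix hL
  have hPu' : IsUnit P.transpose.det := by rwa [Matrix.det_transpose]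
  rw [innerMat, innerMat, formMat_comp, formMat_comp, ← hP]
  simp only [Matrix.transpose_mul, Matrix.mul_inv_rev, Matrix.transpose_transpose,
    Matrix.transpose_nonsing_inv]
  have h1 : ∀ X Y : Matrix (Fin n × Fin 2) (Fin n × Fin 2) ℝ,
      X * P⁻¹.transpose * (P.transpose * Y) = X * Y := fun X Y => by
    rw [Matrix.mul_assoc, ← Matrix.mul_assoc P⁻¹.transpose, ← Matrix.transpose_mul,
      Matrix.mul_nonsing_inv _ hPu, Matrix.transpose_one, Matrix.one_mul]
  have h2 : ∀ X : Matrix (Fin n × Fin 2) (Fin n × Fin 2) ℝ, P * (P⁻¹ * X) = X := fun X => by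
    rw [← Matrix.mul_assoc, Matrix.mul_nonsing_inv _ hPu, Matrix.one_mul]
  have h3 : ∀ X : Matrix (Fin n × Fin 2) (Fin n × Fin 2) ℝ,
      (P.transpose)⁻¹ * (P.transpose * X) = X := fun X => by
    rw [← Matrix.mul_assoc, Matrix.nonsing_inv_mul _ hPu', Matrix.one_mul]
  simp only [Matrix.mul_assoc, h2, h3]
  rw [Matrix.trace_mul_comm]
  simp only [Matrix.mul_assoc, Matrix.mul_nonsing_inv _ hPu, Matrix.mul_one]

end LinearAlgebra

/-! ### The Laplacian of a Kähler metric and its variation -/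

section Kahler

variable {n : ℕ} {M : Type*} [TopologicalSpace M] [ChartedSpace (Cn n) M]

theorem gramAt_metricOf (Ω : DForm n M 2) (x : M) :
    gramAt (metricOf Ω) x = symMat (formAt M Ω x) := rfl

theorem formInner_eq_innerMat (Ω β γ : DForm n M 2) (x : M) :
    formInner (metricOf Ω) x (β x) (γ x) =
      innerMat (symMat (formAt M Ω x))⁻¹ (formAt M β x) (formAt M γ x) := by
  rw [innerMat, formInner, gramAt_metricOf]
  set K := (symMat (formAt M Ω x))⁻¹
  have h : ∀ B C : Matrix (Fin n × Fin 2) (Fin n × Fin 2) ℝ,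
      ∑ a, ∑ b, ∑ c, ∑ d, K a c * K b d * B a b * C c d =
        (K.transpose * B * K * C.transpose).trace := fun B C => by
    simp only [Matrix.trace, Matrix.diag, Matrix.mul_apply, Matrix.transpose_apply,
      Finset.sum_mul]
    have e : ∀ a b c d, K a c * K b d * B a b * C c d = K a c * B a b * K b d * C c d :=
      fun a b c d => by ring
    simp only [e]
    have h1 : ∀ a, ∑ b, ∑ c, ∑ d, K a c * B a b * K b d * C c d =
        ∑ c, ∑ d, ∑ b, K a c * B a b * K b d * C c d := fun a => by
      rw [Finset.sum_comm]
      exact Finset.sum_congr rfl fun c _ => Finset.sum_comm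
    simp only [h1]
    rw [Finset.sum_comm]
    refine Finset.sum_congr rfl fun c _ => ?_
    rw [Finset.sum_comm]
    refine Finset.sum_congr rfl fun d _ => ?_
    rw [Finset.sum_comm]
  exact congrArg (1 / 2 * ·) (h (formMat (formAt M β x)) (formMat (formAt M γ x)))

theorem IsOneOne.isInvariant {α : DForm n M 2} (hα : IsOneOne α) (x : M) :
    IsInvariant (formAt M α x) := fun v w => hα x v w

theorem form_apply_I_smul (β : Cn n [⋀^Fin 2]→L[ℝ] ℝ) (v w : Cn n) :
    β ![v, Complex.I • w] =
      (stdBasis n).repr v ⬝ᵥ (symMat β).mulVec ((stdBasis n).repr w) := by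
  have h : symMat β =
      LinearMap.BilinForm.toMatrix (stdBasis n) ((bilinOf β).compRight (mulI n)) := by
    ext a b
    rw [LinearMap.BilinForm.toMatrix_apply, stdBasis_apply, stdBasis_apply]
    rfl
  rw [h, ← LinearMap.BilinForm.apply_eq_dotProduct_toMatrix_mulVec]
  rfl

theorem IsKahlerForm.posDef {Ω : DForm n M 2} (hΩ : IsKahlerForm Ω) (x : M) :
    (symMat (formAt M Ω x)).PosDef := by
  refine Matrix.PosDef.of_dotProduct_mulVec_pos ?_ fun c hc => ?_
  · rw [Matrix.IsHermitian, Matrix.conjTranspose_eq_transpose_of_trivial]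
    exact (hΩ.1.2.1.isInvariant x).transpose_symMat
  · have h1 := hΩ.2 x ((stdBasis n).equivFun.symm c)
      ((stdBasis n).equivFun.symm.map_ne_zero_iff.2 hc)
    have h2 := form_apply_I_smul (formAt M Ω x) ((stdBasis n).equivFun.symm c)
      ((stdBasis n).equivFun.symm c)
    have h3 : ⇑((stdBasis n).repr ((stdBasis n).equivFun.symm c)) = c :=
      (stdBasis n).equivFun.apply_symm_apply c
    rw [h3] at h2
    rw [star_trivial, ← h2]
    exact h1

theorem IsKahlerForm.det_pos {Ω : DForm n M 2} (hΩ : IsKahlerForm Ω) (x : M) :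
    0 < (symMat (formAt M Ω x)).det := (hΩ.posDef x).det_pos

theorem IsKahlerForm.inv_mul_self {Ω : DForm n M 2} (hΩ : IsKahlerForm Ω) (x : M) :
    (symMat (formAt M Ω x))⁻¹ * symMat (formAt M Ω x) = 1 :=
  Matrix.nonsing_inv_mul _ (isUnit_iff_ne_zero.2 (hΩ.det_pos x).ne')

theorem metricOf_smul (c : ℝ) (Ω : DForm n M 2) : c • metricOf Ω = metricOf (c • Ω) := rfl

variable [IsManifold 𝓘(ℂ, Cn n) ∞ M]

theorem gramIn_metricOf (Ω : DForm n M 2) {e : OpenPartialHomeomorph M (Cn n)}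
    (he : e ∈ atlas (Cn n) M) {y : Cn n} (hy : y ∈ e.target) :
    gramIn (metricOf Ω) e y = symMat (inChart Ω e y) := by
  ext a b
  exact metricOf_symmDeriv Ω he hy _ _

theorem symMat_inChart (Ω : DForm n M 2) {e : OpenPartialHomeomorph M (Cn n)}
    (he : e ∈ atlas (Cn n) M) {y : Cn n} (hy : y ∈ e.target) :
    symMat (inChart Ω e y) =
      (LinearMap.toMatrix (stdBasis n) (stdBasis n) (symmDeriv e y).toLinearMap).transpose *
        symMat (formAt M Ω (e.symm y)) *
        LinearMap.toMatrix (stdBasis n) (stdBasis n) (symmDeriv e y).toLinearMap :=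
  symMat_comp _ _ (symmDeriv_I_smul he hy)

/-- The pointwise inner product of 2-forms can be computed in any chart. -/
theorem formInner_eq_inChart (Ω β γ : DForm n M 2) {e : OpenPartialHomeomorph M (Cn n)}
    (he : e ∈ atlas (Cn n) M) {y : Cn n} (hy : y ∈ e.target) :
    formInner (metricOf Ω) (e.symm y) (β (e.symm y)) (γ (e.symm y)) =
      innerMat (symMat (inChart Ω e y))⁻¹ (inChart β e y) (inChart γ e y) := by
  rw [formInner_eq_innerMat, symMat_inChart Ω he hy]
  exact (innerMat_comp _ (symmDeriv_bijective he hy) _ _).symm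

/-- The matrix of second derivatives of a function on `ℂⁿ` in the real coordinates. -/
def hessMat (F : Cn n → ℝ) (y : Cn n) : Matrix (Fin n × Fin 2) (Fin n × Fin 2) ℝ :=
  Matrix.of fun a b => fderiv ℝ (fderiv ℝ F) y (basisVec a) (basisVec b)

/-- The symmetric form associated with `dd^c f` is twice the `J`-invariant part of the Hessian. -/
theorem symMat_inChart_ddc {f : M → ℝ} (hf : ContMDiff 𝓘(ℝ, Cn n) 𝓘(ℝ, ℝ) ∞ f)
    {e : OpenPartialHomeomorph M (Cn n)} (he : e ∈ atlas (Cn n) M) {y : Cn n}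
    (hy : y ∈ e.target) :
    symMat (inChart (ddc n f) e y) = hessMat (f ∘ e.symm) y +
      (matI n).transpose * hessMat (f ∘ e.symm) y * matI n := by
  have hC : ContDiffAt ℝ ∞ (f ∘ e.symm) y :=
    (contDiffOn_comp_symm hf he).contDiffAt (e.open_target.mem_nhds hy)
  have hsymm : IsSymmSndFDerivAt ℝ (f ∘ e.symm) y :=
    hC.isSymmSndFDerivAt (by rw [minSmoothness_of_isRCLikeNormedField]; exact ENat.LEInfty.out)
  set B : LinearMap.BilinForm ℝ (Cn n) :=
    (ContinuousLinearMap.coeLM ℝ).comp (fderiv ℝ (fderiv ℝ (f ∘ e.symm)) y).toLinearMap with hB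
  have hBapply : ∀ v w, B v w = fderiv ℝ (fderiv ℝ (f ∘ e.symm)) y v w := fun v w => rfl
  have hh : hessMat (f ∘ e.symm) y = LinearMap.BilinForm.toMatrix (stdBasis n) B := by
    ext a b
    rw [LinearMap.BilinForm.toMatrix_apply, stdBasis_apply, stdBasis_apply]
    rfl
  have h2 : (matI n).transpose * hessMat (f ∘ e.symm) y * matI n =
      LinearMap.BilinForm.toMatrix (stdBasis n) (B.comp (mulI n) (mulI n)) := by
    rw [hh, matI, ← LinearMap.BilinForm.toMatrix_comp]
  rw [h2, hh]
  ext a b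
  rw [Matrix.add_apply, LinearMap.BilinForm.toMatrix_apply, LinearMap.BilinForm.toMatrix_apply,
    stdBasis_apply, stdBasis_apply, LinearMap.BilinForm.comp_apply, mulI_apply, mulI_apply,
    hBapply, hBapply, symMat, Matrix.of_apply, inChart_ddc hf he hy, smul_smul, Complex.I_mul_I,
    hsymm.eq (Complex.I • basisVec b)]
  simp only [neg_smul, one_smul, map_neg]
  ring

/-- In the Kähler case the Laplacian has no first-order term in holomorphic coordinates: it is
minus the trace of the coordinate Hessian. -/
theorem laplacian_eq_neg_trace {Ω : DForm n M 2} (hΩ : IsClosedOneOne Ω) {f : M → ℝ}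
    (hf : ContMDiff 𝓘(ℝ, Cn n) 𝓘(ℝ, ℝ) ∞ f) (x : M)
    (hdet : 0 < (symMat (formAt M Ω x)).det) :
    laplacian (metricOf Ω) f x = -((symMat (formAt M Ω x))⁻¹ *
      hessMat (f ∘ (chartAt (Cn n) x).symm) (chartAt (Cn n) x x)).trace := by
  have he := chart_mem_atlas (Cn n) x
  have hy := (chartAt (Cn n) x).map_source (mem_chart_source (Cn n) x)
  have hself := inChart_chartAt_self Ω x
  have hext := formAt_extD Ω x
  set e := chartAt (Cn n) x
  set y := e x
  have hC : ContDiffAt ℝ ∞ (f ∘ e.symm) y :=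
    (contDiffOn_comp_symm hf he).contDiffAt (e.open_target.mem_nhds hy)
  have hsymm : IsSymmSndFDerivAt ℝ (f ∘ e.symm) y :=
    hC.isSymmSndFDerivAt (by rw [minSmoothness_of_isRCLikeNormedField]; exact ENat.LEInfty.out)
  have hgram : ∀ᶠ z in 𝓝 y, gramIn (metricOf Ω) e z =
      -(matI n).transpose * formMat (inChart Ω e z) := by
    filter_upwards [e.open_target.mem_nhds hy] with z hz
    rw [gramIn_metricOf Ω he hz]
    exact IsInvariant.symMat_eq (hΩ.2.1.inChart he hz)
  have hgy : gramIn (metricOf Ω) e y = symMat (formAt M Ω x) := by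
    rw [gramIn_metricOf Ω he hy, hself]
  have hd2 : DifferentiableAt ℝ (fderiv ℝ (f ∘ e.symm)) y :=
    (((contDiffOn_comp_symm hf he).fderiv_of_isOpen e.open_target
      (m := ∞) (by simp)).differentiableOn (by simp)).differentiableAt (e.open_target.mem_nhds hy)
  have hu : ∀ c : Fin n × Fin 2, (fun z => inChart (dFun n f) e z ![basisVec c]) =ᶠ[𝓝 y]
      fun z => fderiv ℝ (f ∘ e.symm) z (basisVec c) := fun c => by
    filter_upwards [e.open_target.mem_nhds hy] with z hz
    exact inChart_dFun hf he hz _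
  have hw : DifferentiableAt ℝ (inChart Ω e) y := hΩ.1.differentiableAt he hy
  have hwv : ∀ v, DifferentiableAt ℝ (fun z => inChart Ω e z v) y := fun v =>
    (ContinuousAlternatingMap.apply ℝ (Cn n) ℝ v).differentiableAt.comp y hw
  have hclosed : ∀ a i j : Fin n × Fin 2,
      fderiv ℝ (fun z => formMat (inChart Ω e z) i j) y (basisVec a) +
      fderiv ℝ (fun z => formMat (inChart Ω e z) j a) y (basisVec i) +
      fderiv ℝ (fun z => formMat (inChart Ω e z) a i) y (basisVec j) = 0 := fun a i j => by
    have h0 : extDeriv (inChart Ω e) y = 0 := by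
      rw [← hext, hΩ.2.2]
      rfl
    have h1 := extDeriv_apply hw ![basisVec a, basisVec i, basisVec j]
    rw [h0, Fin.sum_univ_three] at h1
    have r0 : Fin.removeNth 0 ![basisVec a, basisVec i, basisVec j] =
        (![basisVec i, basisVec j] : Fin 2 → Cn n) := by
      funext k; fin_cases k <;> rfl
    have r1 : Fin.removeNth 1 ![basisVec a, basisVec i, basisVec j] =
        (![basisVec a, basisVec j] : Fin 2 → Cn n) := by
      funext k; fin_cases k <;> rfl
    have r2 : Fin.removeNth 2 ![basisVec a, basisVec i, basisVec j] =
        (![basisVec a, basisVec i] : Fin 2 → Cn n) := by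
      funext k; fin_cases k <;> rfl
    have s1 : (fun z => inChart Ω e z ![basisVec a, basisVec j]) =
        fun z => -inChart Ω e z ![basisVec j, basisVec a] := funext fun z => form_swap _ _ _
    rw [r0, r1, r2, s1, fderiv_fun_neg] at h1
    simp only [formMat, Matrix.of_apply]
    simp at h1
    linarith
  have key := sum_fderiv_sqrt_det_mul (b := basisVec) (G := gramIn (metricOf Ω) e)
    (w := fun z => formMat (inChart Ω e z)) (jm := -(matI n).transpose) (y := y)
    (u := fun z c => inChart (dFun n f) e z ![basisVec c]) hgram
    (by
      rw [Matrix.det_neg, Matrix.det_transpose]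
      exact mul_ne_zero (pow_ne_zero _ (by norm_num)) det_matI_ne_zero)
    (by rwa [hgy]) (fun i j => hwv _)
    (fun c => (hd2.clm_apply (differentiableAt_const _)).congr_of_eventuallyEq (hu c))
    (fun z i j => form_swap (inChart Ω e z) _ _) hclosed
  have hlap : laplacian (metricOf Ω) f x =
      -((√(gramIn (metricOf Ω) e y).det)⁻¹ * ∑ a, fderiv ℝ (fun z =>
        √(gramIn (metricOf Ω) e z).det * ∑ b, (gramIn (metricOf Ω) e z)⁻¹ a b *
          inChart (dFun n f) e z ![basisVec b]) y (basisVec a)) := rfl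
  rw [hlap, key, hgy, ← mul_assoc, inv_mul_cancel₀ (Real.sqrt_pos.2 hdet).ne', one_mul]
  congr 1
  refine Finset.sum_congr rfl fun a _ => Finset.sum_congr rfl fun c _ => ?_
  change _ = (symMat (formAt M Ω x))⁻¹ a c *
    fderiv ℝ (fderiv ℝ (f ∘ e.symm)) y (basisVec c) (basisVec a)
  rw [(hu c).fderiv_eq, fderiv_clm_apply hd2 (differentiableAt_const _), ← hsymm.eq]
  simp

theorem IsClosedOneOne.smul {α : DForm n M 2} (hα : IsClosedOneOne α) (c : ℝ) :
    IsClosedOneOne (c • α) := by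
  have h : α + (c - 1) • α = c • α := by
    funext x
    refine ContinuousAlternatingMap.ext fun v => ?_
    change α x v + (c - 1) * α x v = c * α x v
    ring
  exact h ▸ hα.add_smul hα (c - 1)

/-- The variation of the Laplacian along `c(t) (ω + t α)` for a rescaling that is stationary
at `t = 0`. -/
theorem hasDerivAt_laplacian {Ω α : DForm n M 2} (hΩ : IsKahlerForm Ω) (hα : IsClosedOneOne α)
    {c : ℝ → ℝ} (hc0 : c 0 = 1) (hc : HasDerivAt c 0 0) {f : M → ℝ}
    (hf : ContMDiff 𝓘(ℝ, Cn n) 𝓘(ℝ, ℝ) ∞ f) (x : M) :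
    HasDerivAt (fun t : ℝ => laplacian (c t • metricOf (Ω + t • α)) f x)
      (formInner (metricOf Ω) x (ddc n f x) (α x)) 0 := by
  have he := chart_mem_atlas (Cn n) x
  have hy := (chartAt (Cn n) x).map_source (mem_chart_source (Cn n) x)
  set h := hessMat (f ∘ (chartAt (Cn n) x).symm) (chartAt (Cn n) x x) with hh
  set S := symMat (formAt M Ω x) with hS
  set A := symMat (formAt M α x) with hA
  have hddc : symMat (formAt M (ddc n f) x) = h + (matI n).transpose * h * matI n := by
    rw [← inChart_chartAt_self, symMat_inChart_ddc hf he hy]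
  have hval : formInner (metricOf Ω) x (ddc n f x) (α x) = (S⁻¹ * A * S⁻¹ * h).trace := by
    rw [formInner_eq_innerMat]
    exact innerMat_eq_trace_of_symMat_eq (hΩ.1.2.1.isInvariant x) (hα.2.1.isInvariant x) hddc
  set G : ℝ → Matrix (Fin n × Fin 2) (Fin n × Fin 2) ℝ := fun t => c t • (S + t • A) with hG
  have hG0 : G 0 = S := by simp [hG, hc0]
  have hdet : 0 < (G 0).det := by
    rw [hG0]
    exact hΩ.det_pos x
  have hGd : ∀ i j, HasDerivAt (fun t => G t i j) (A i j) 0 := fun i j => by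
    have h1 := hc.mul (((hasDerivAt_id (0 : ℝ)).mul_const (A i j)).const_add (S i j))
    simp only [hc0, one_mul, zero_mul, zero_add] at h1
    exact h1
  have hpos : ∀ᶠ t in 𝓝 (0 : ℝ), 0 < (G t).det :=
    (hasDerivAt_det_adjugate hGd).continuousAt.eventually (lt_mem_nhds hdet)
  have hev : (fun t : ℝ => laplacian (c t • metricOf (Ω + t • α)) f x) =ᶠ[𝓝 0]
      fun t => -((G t)⁻¹ * h).trace := by
    filter_upwards [hpos] with t ht
    rw [metricOf_smul]
    exact laplacian_eq_neg_trace ((hΩ.1.add_smul hα t).smul (c t)) hf x ht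
  refine HasDerivAt.congr_of_eventuallyEq ?_ hev
  rw [hval]
  have h1 : HasDerivAt (fun t => -((G t)⁻¹ * h).trace)
      (-(∑ i, ∑ j, -((G 0)⁻¹ * A * (G 0)⁻¹) i j * h j i)) 0 := by
    simp only [Matrix.trace, Matrix.diag, Matrix.mul_apply]
    refine (HasDerivAt.fun_sum fun i _ => HasDerivAt.fun_sum fun j _ => ?_).neg
    exact (hasDerivAt_matrix_inv hGd hdet.ne' i j).mul_const (h j i)
  have h2 : (S⁻¹ * A * S⁻¹ * h).trace =
      -(∑ i, ∑ j, -((G 0)⁻¹ * A * (G 0)⁻¹) i j * h j i) := by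
    rw [hG0]
    simp only [neg_mul, Finset.sum_neg_distrib, neg_neg]
    rfl
  rw [h2]
  exact h1

end Kahler

/-! ### Continuity, and stability of the Kähler condition -/

section Continuity

variable {n : ℕ} {M : Type*} [TopologicalSpace M] [ChartedSpace (Cn n) M]

/-- Continuity of a function with a parameter on a manifold can be checked in charts. -/
theorem continuous_of_continuousOn_charts {T Z : Type*} [TopologicalSpace T] [TopologicalSpace Z]
    {φ : T → M → Z}
    (h : ∀ e ∈ atlas (Cn n) M,
      ContinuousOn (fun p : T × Cn n => φ p.1 (e.symm p.2)) (Set.univ ×ˢ e.target)) :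
    Continuous fun p : T × M => φ p.1 p.2 := by
  refine continuous_iff_continuousAt.2 fun ⟨t, x⟩ => ?_
  have hx := mem_chart_source (Cn n) x
  have he := h _ (chart_mem_atlas (Cn n) x)
  set e := chartAt (Cn n) x
  have h1 : ContinuousAt (fun p : T × Cn n => φ p.1 (e.symm p.2)) (t, e x) :=
    he.continuousAt ((isOpen_univ.prod e.open_target).mem_nhds ⟨Set.mem_univ _, e.map_source hx⟩)
  have h2 : ContinuousAt (fun p : T × M => (p.1, e p.2)) (t, x) :=
    continuousAt_fst.prodMk
      (ContinuousAt.comp (x := (t, x)) (e.continuousAt hx) continuousAt_snd)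
  have h3 := ContinuousAt.comp (f := fun p : T × M => (p.1, e p.2))
    (g := fun p : T × Cn n => φ p.1 (e.symm p.2)) (x := (t, x)) h1 h2
  refine h3.congr ?_
  filter_upwards [(isOpen_univ.prod e.open_source).mem_nhds
    (show (t, x) ∈ Set.univ ×ˢ e.source from ⟨Set.mem_univ _, hx⟩)] with p hp
  simp only [Function.comp_apply]
  rw [e.left_inv hp.2]

theorem continuous_of_continuousOn_charts' {Z : Type*} [TopologicalSpace Z] {φ : M → Z}
    (h : ∀ e ∈ atlas (Cn n) M, ContinuousOn (fun y => φ (e.symm y)) e.target) : Continuous φ := by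
  have h1 := continuous_of_continuousOn_charts (T := Unit) (φ := fun _ => φ) fun e he =>
    (h e he).comp continuousOn_snd fun p hp => hp.2
  exact h1.comp (Continuous.prodMk_right ())

theorem IsSmoothForm.continuousOn_symMat {α : DForm n M 2} (hα : IsSmoothForm α)
    {e : OpenPartialHomeomorph M (Cn n)} (he : e ∈ atlas (Cn n) M) :
    ContinuousOn (fun y => symMat (inChart α e y)) e.target :=
  continuousOn_pi.2 fun _ => continuousOn_pi.2 fun _ => (hα.contDiffOn_apply he _).continuousOn

theorem continuousOn_formMat {α : DForm n M 2} {e : OpenPartialHomeomorph M (Cn n)}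
    (h : ContinuousOn (fun y => symMat (inChart α e y)) e.target) :
    ContinuousOn (fun y => formMat (inChart α e y)) e.target := by
  simp only [formMat_eq_symMat]
  exact (h.mul continuousOn_const).neg

theorem continuousOn_inv {X ι : Type*} [TopologicalSpace X] [Fintype ι] [DecidableEq ι] {s : Set X}
    {G : X → Matrix ι ι ℝ} (hG : ContinuousOn G s) (hdet : ∀ y ∈ s, (G y).det ≠ 0) :
    ContinuousOn (fun y => (G y)⁻¹) s := by
  simp only [Matrix.inv_def, Ring.inverse_eq_inv']
  have h1 : ContinuousOn (fun y => (G y).det) s := continuous_id.matrix_det.comp_continuousOn hG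
  have h2 : ContinuousOn (fun y => (G y).adjugate) s :=
    continuous_id.matrix_adjugate.comp_continuousOn hG
  exact (h1.inv₀ hdet).smul h2

/-- The ratio `det (g + t a) / det g` of Gram determinants, where `g` and `a` are the symmetric
forms of `ω` and `α`: the square of the ratio of the volume
densities; it does not depend on the coordinates. -/
def detRatio (Ω α : DForm n M 2) (t : ℝ) (x : M) : ℝ :=
  (symMat (formAt M (Ω + t • α) x)).det / (symMat (formAt M Ω x)).det

/-- The derivative of `detRatio` in `t`. -/
def detRatioDeriv (Ω α : DForm n M 2) (t : ℝ) (x : M) : ℝ :=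
  ((symMat (formAt M (Ω + t • α) x)).adjugate * symMat (formAt M α x)).trace /
    (symMat (formAt M Ω x)).det

theorem hasDerivAt_detRatio (Ω α : DForm n M 2) (t : ℝ) (x : M) :
    HasDerivAt (fun s => detRatio Ω α s x) (detRatioDeriv Ω α t x) t := by
  refine HasDerivAt.div_const (hasDerivAt_det_adjugate fun i j => ?_) _
  have h := ((hasDerivAt_id t).mul_const (symMat (formAt M α x) i j)).const_add
    (symMat (formAt M Ω x) i j)
  rw [one_mul] at h
  exact h

theorem detRatio_zero {Ω : DForm n M 2} (hΩ : IsKahlerForm Ω) (α : DForm n M 2) (x : M) :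
    detRatio Ω α 0 x = 1 := by
  have h : formAt M (Ω + (0 : ℝ) • α) x = formAt M Ω x := by
    refine ContinuousAlternatingMap.ext fun v => ?_
    change Ω x v + 0 * α x v = Ω x v
    ring
  rw [detRatio, h, div_self (hΩ.det_pos x).ne']

/-- The first variation of the volume density is the inner product with the Kähler form. -/
theorem detRatioDeriv_zero {Ω α : DForm n M 2} (hΩ : IsKahlerForm Ω) (x : M) :
    detRatioDeriv Ω α 0 x = 2 * formInner (metricOf Ω) x (α x) (Ω x) := by
  have h : formAt M (Ω + (0 : ℝ) • α) x = formAt M Ω x := by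
    refine ContinuousAlternatingMap.ext fun v => ?_
    change Ω x v + 0 * α x v = Ω x v
    ring
  have hinv := hΩ.1.2.1.isInvariant x
  rw [detRatioDeriv, h, trace_adjugate_mul (hΩ.det_pos x).ne',
    mul_div_cancel_left₀ _ (hΩ.det_pos x).ne', formInner_eq_innerMat,
    innerMat_eq_trace_symMat hinv hinv, Matrix.mul_assoc _ (symMat (formAt M Ω x))⁻¹,
    hΩ.inv_mul_self, Matrix.mul_one]
  ring

theorem continuousOn_symMat_add_smul {Ω α : DForm n M 2} (hΩ : IsSmoothForm Ω)
    (hα : IsSmoothForm α) {e : OpenPartialHomeomorph M (Cn n)} (he : e ∈ atlas (Cn n) M) :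
    ContinuousOn (fun p : ℝ × Cn n => symMat (inChart (Ω + p.1 • α) e p.2))
      (Set.univ ×ˢ e.target) := by
  have h1 : ContinuousOn (fun p : ℝ × Cn n => symMat (inChart Ω e p.2)) (Set.univ ×ˢ e.target) :=
    (hΩ.continuousOn_symMat he).comp continuousOn_snd fun p hp => hp.2
  have h2 : ContinuousOn (fun p : ℝ × Cn n => symMat (inChart α e p.2)) (Set.univ ×ˢ e.target) :=
    (hα.continuousOn_symMat he).comp continuousOn_snd fun p hp => hp.2
  exact h1.add (continuousOn_fst.smul h2)

variable [IsManifold 𝓘(ℂ, Cn n) ∞ M]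

theorem det_symMat_inChart (Ω : DForm n M 2) {e : OpenPartialHomeomorph M (Cn n)}
    (he : e ∈ atlas (Cn n) M) {y : Cn n} (hy : y ∈ e.target) :
    (symMat (inChart Ω e y)).det =
      (LinearMap.toMatrix (stdBasis n) (stdBasis n) (symmDeriv e y).toLinearMap).det ^ 2 *
        (symMat (formAt M Ω (e.symm y))).det := by
  rw [symMat_inChart Ω he hy, Matrix.det_mul, Matrix.det_mul, Matrix.det_transpose]
  ring

theorem det_symmDeriv_ne_zero {e : OpenPartialHomeomorph M (Cn n)}
    (he : e ∈ atlas (Cn n) M) {y : Cn n} (hy : y ∈ e.target) :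
    (LinearMap.toMatrix (stdBasis n) (stdBasis n) (symmDeriv e y).toLinearMap).det ≠ 0 :=
  (isUnit_det_toMatrix (symmDeriv_bijective he hy)).ne_zero

theorem IsKahlerForm.det_inChart_pos {Ω : DForm n M 2} (hΩ : IsKahlerForm Ω)
    {e : OpenPartialHomeomorph M (Cn n)} (he : e ∈ atlas (Cn n) M) {y : Cn n}
    (hy : y ∈ e.target) : 0 < (symMat (inChart Ω e y)).det := by
  rw [det_symMat_inChart Ω he hy]
  have := det_symmDeriv_ne_zero he hy
  have := hΩ.det_pos (e.symm y)
  positivity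

theorem continuousOn_innerMat {Ω : DForm n M 2} (hΩ : IsKahlerForm Ω) {β γ : DForm n M 2}
    {e : OpenPartialHomeomorph M (Cn n)} (he : e ∈ atlas (Cn n) M)
    (hβ : ContinuousOn (fun y => symMat (inChart β e y)) e.target)
    (hγ : ContinuousOn (fun y => symMat (inChart γ e y)) e.target) :
    ContinuousOn (fun y => innerMat (symMat (inChart Ω e y))⁻¹ (inChart β e y) (inChart γ e y))
      e.target := by
  have hK : ContinuousOn (fun y => (symMat (inChart Ω e y))⁻¹) e.target :=
    continuousOn_inv (hΩ.1.1.continuousOn_symMat he) fun y hy => (hΩ.det_inChart_pos he hy).ne'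
  have ht : ∀ {A : Cn n → Matrix (Fin n × Fin 2) (Fin n × Fin 2) ℝ}, ContinuousOn A e.target →
      ContinuousOn (fun y => (A y).transpose) e.target := fun h =>
    continuous_id.matrix_transpose.comp_continuousOn h
  exact continuousOn_const.mul (continuous_id.matrix_trace.comp_continuousOn
    ((((ht hK).mul (continuousOn_formMat hβ)).mul hK).mul
      (ht (continuousOn_formMat hγ))))

theorem continuous_formInner_ddc {Ω α : DForm n M 2} (hΩ : IsKahlerForm Ω)
    (hα : IsSmoothForm α) {f : M → ℝ} (hf : ContMDiff 𝓘(ℝ, Cn n) 𝓘(ℝ, ℝ) ∞ f) :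
    Continuous fun x => formInner (metricOf Ω) x (ddc n f x) (α x) := by
  refine continuous_of_continuousOn_charts' (n := n) fun e he => ?_
  have hd : ContinuousOn (fun y => symMat (inChart (ddc n f) e y)) e.target := by
    have h1 : ContinuousOn (fderiv ℝ (fderiv ℝ (f ∘ e.symm))) e.target :=
      (((contDiffOn_comp_symm hf he).fderiv_of_isOpen e.open_target (m := ∞)
        (by simp)).fderiv_of_isOpen e.open_target (m := ∞) (by simp)).continuousOn
    have h2 : ContinuousOn (hessMat (f ∘ e.symm)) e.target :=
      continuousOn_pi.2 fun _ => continuousOn_pi.2 fun _ =>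
        (h1.clm_apply continuousOn_const).clm_apply continuousOn_const
    refine ContinuousOn.congr ?_ fun y hy => symMat_inChart_ddc hf he hy
    exact h2.add ((continuousOn_const.mul h2).mul continuousOn_const)
  exact (continuousOn_innerMat hΩ he hd (hα.continuousOn_symMat he)).congr fun y hy =>
    formInner_eq_inChart Ω (ddc n f) α he hy

/-- Both Gram determinants change by the squared Jacobian determinant of the chart, so their ratio
can be computed in any chart. -/
theorem detRatio_eq_inChart (Ω α : DForm n M 2) (t : ℝ) {e : OpenPartialHomeomorph M (Cn n)}
    (he : e ∈ atlas (Cn n) M) {y : Cn n} (hy : y ∈ e.target) :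
    detRatio Ω α t (e.symm y) =
      (symMat (inChart (Ω + t • α) e y)).det / (symMat (inChart Ω e y)).det := by
  rw [detRatio, det_symMat_inChart _ he hy, det_symMat_inChart _ he hy,
    mul_div_mul_left _ _ (pow_ne_zero 2 (det_symmDeriv_ne_zero he hy))]

theorem detRatioDeriv_eq_inChart (Ω α : DForm n M 2) (t : ℝ)
    {e : OpenPartialHomeomorph M (Cn n)} (he : e ∈ atlas (Cn n) M) {y : Cn n}
    (hy : y ∈ e.target) :
    detRatioDeriv Ω α t (e.symm y) =
      ((symMat (inChart (Ω + t • α) e y)).adjugate * symMat (inChart α e y)).trace /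
        (symMat (inChart Ω e y)).det := by
  -- Both sides are the derivative of the same function of `t`.
  refine (hasDerivAt_detRatio Ω α t (e.symm y)).unique ?_
  simp only [detRatio_eq_inChart Ω α _ he hy]
  refine HasDerivAt.div_const (hasDerivAt_det_adjugate fun i j => ?_) _
  have h := ((hasDerivAt_id t).mul_const (symMat (inChart α e y) i j)).const_add
    (symMat (inChart Ω e y) i j)
  rw [one_mul] at h
  exact h

theorem continuous_detRatio {Ω α : DForm n M 2} (hΩ : IsKahlerForm Ω) (hα : IsSmoothForm α) :
    Continuous fun p : ℝ × M => detRatio Ω α p.1 p.2 := by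
  refine continuous_of_continuousOn_charts (n := n) fun e he => ?_
  have h1 : ContinuousOn (fun p : ℝ × Cn n => (symMat (inChart Ω e p.2)).det)
      (Set.univ ×ˢ e.target) :=
    (continuous_id.matrix_det.comp_continuousOn (hΩ.1.1.continuousOn_symMat he)).comp
      continuousOn_snd fun p hp => hp.2
  exact ((continuous_id.matrix_det.comp_continuousOn
    (continuousOn_symMat_add_smul hΩ.1.1 hα he)).div h1
      fun p hp => (hΩ.det_inChart_pos he hp.2).ne').congr
    fun p hp => detRatio_eq_inChart Ω α p.1 he hp.2

theorem continuous_detRatioDeriv {Ω α : DForm n M 2} (hΩ : IsKahlerForm Ω) (hα : IsSmoothForm α) :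
    Continuous fun p : ℝ × M => detRatioDeriv Ω α p.1 p.2 := by
  refine continuous_of_continuousOn_charts (n := n) fun e he => ?_
  have h1 : ContinuousOn (fun p : ℝ × Cn n => (symMat (inChart Ω e p.2)).det)
      (Set.univ ×ˢ e.target) :=
    (continuous_id.matrix_det.comp_continuousOn (hΩ.1.1.continuousOn_symMat he)).comp
      continuousOn_snd fun p hp => hp.2
  have h2 : ContinuousOn (fun p : ℝ × Cn n => symMat (inChart α e p.2)) (Set.univ ×ˢ e.target) :=
    (hα.continuousOn_symMat he).comp continuousOn_snd fun p hp => hp.2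
  have h3 : ContinuousOn (fun p : ℝ × Cn n => (symMat (inChart (Ω + p.1 • α) e p.2)).adjugate)
      (Set.univ ×ˢ e.target) :=
    continuous_id.matrix_adjugate.comp_continuousOn (continuousOn_symMat_add_smul hΩ.1.1 hα he)
  exact ((continuous_id.matrix_trace.comp_continuousOn (h3.mul h2)).div h1
      fun p hp => (hΩ.det_inChart_pos he hp.2).ne').congr
    fun p hp => detRatioDeriv_eq_inChart Ω α p.1 he hp.2

theorem continuous_detRatio_right {Ω α : DForm n M 2} (hΩ : IsKahlerForm Ω) (hα : IsSmoothForm α)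
    (t : ℝ) : Continuous fun x => detRatio Ω α t x :=
  Continuous.comp (g := fun p : ℝ × M => detRatio Ω α p.1 p.2) (f := fun x : M => (t, x))
    (continuous_detRatio hΩ hα) (Continuous.prodMk_right t)

theorem continuous_detRatioDeriv_right {Ω α : DForm n M 2} (hΩ : IsKahlerForm Ω)
    (hα : IsSmoothForm α) (t : ℝ) : Continuous fun x => detRatioDeriv Ω α t x :=
  Continuous.comp (g := fun p : ℝ × M => detRatioDeriv Ω α p.1 p.2) (f := fun x : M => (t, x))
    (continuous_detRatioDeriv hΩ hα) (Continuous.prodMk_right t)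

/-- By compactness the ratio of Gram determinants stays near its value `1` at `t = 0`, uniformly on
the manifold; with the bound `1/4` the factor `2 √ratio` in the derivative of its square root is at
least `1`. -/
theorem eventually_detRatio_gt [CompactSpace M] {Ω α : DForm n M 2} (hΩ : IsKahlerForm Ω)
    (hα : IsSmoothForm α) : ∀ᶠ t in 𝓝 (0 : ℝ), ∀ x : M, 1 / 4 < detRatio Ω α t x := by
  have h := isCompact_univ.eventually_forall_of_forall_eventually (x₀ := (0 : ℝ))
    (P := fun t (x : M) => 1 / 4 < detRatio Ω α t x) fun x _ =>
      (continuous_detRatio hΩ hα).continuousAt.eventually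
        (lt_mem_nhds (by simp only [detRatio_zero hΩ]; norm_num))
  exact h.mono fun t ht x => ht x (Set.mem_univ x)

/-- Being a Kähler form is stable under small deformations by closed `(1,1)`-forms. -/
theorem eventually_isKahlerForm [CompactSpace M] {Ω α : DForm n M 2} (hΩ : IsKahlerForm Ω)
    (hα : IsClosedOneOne α) : ∀ᶠ t in 𝓝 (0 : ℝ), IsKahlerForm (Ω + t • α) := by
  have h := isCompact_univ.eventually_forall_of_forall_eventually (x₀ := (0 : ℝ))
    (P := fun t (x : M) => ∀ v : Tan n x, v ≠ 0 → 0 < metricOf (Ω + t • α) x v v) fun x _ => ?_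
  · exact h.mono fun t ht => ⟨hΩ.1.add_smul hα t, fun x => ht x (Set.mem_univ x)⟩
  have hx := mem_chart_source (Cn n) x
  have he := chart_mem_atlas (Cn n) x
  set e := chartAt (Cn n) x
  have hy := e.map_source hx
  set N : Set (ℝ × Cn n) := Set.univ ×ˢ e.target
  have hN : N ∈ 𝓝 ((0 : ℝ), e x) := (isOpen_univ.prod e.open_target).mem_nhds ⟨Set.mem_univ _, hy⟩
  have hS := (continuousOn_symMat_add_smul hΩ.1.1 hα.1 he).continuousAt hN
  have h0 : symMat (inChart (Ω + (0 : ℝ) • α) e (e x)) = symMat (formAt M Ω x) := by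
    rw [inChart_chartAt_self]
    congr 1
    refine ContinuousAlternatingMap.ext fun v => ?_
    change Ω x v + 0 * α x v = Ω x v
    ring
  -- Positivity on the compact unit sphere persists for nearby parameters and points.
  have h1 : ∀ᶠ p : ℝ × Cn n in 𝓝 (0, e x), ∀ c ∈ Metric.sphere (0 : Fin n × Fin 2 → ℝ) 1,
      0 < c ⬝ᵥ (symMat (inChart (Ω + p.1 • α) e p.2)).mulVec c := by
    refine (isCompact_sphere _ _).eventually_forall_of_forall_eventually fun c hc => ?_
    have hc0 : c ≠ 0 := by
      rintro rfl
      simp at hc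
    have hS' : ContinuousAt (fun q : (ℝ × Cn n) × (Fin n × Fin 2 → ℝ) =>
        symMat (inChart (Ω + q.1.1 • α) e q.1.2)) ((0, e x), c) :=
      ContinuousAt.comp (f := Prod.fst) (x := (((0 : ℝ), e x), c)) hS continuousAt_fst
    have hB : Continuous fun r : Matrix (Fin n × Fin 2) (Fin n × Fin 2) ℝ ×
        (Fin n × Fin 2 → ℝ) => r.2 ⬝ᵥ r.1.mulVec r.2 :=
      continuous_snd.dotProduct (continuous_fst.matrix_mulVec continuous_snd)
    have hcont := ContinuousAt.comp (x := (((0 : ℝ), e x), c)) hB.continuousAt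
      (hS'.prodMk continuousAt_snd)
    refine hcont.eventually (lt_mem_nhds ?_)
    simp only [Function.comp_apply, h0]
    simpa using (hΩ.posDef x).dotProduct_mulVec_pos hc0
  have h2 : ContinuousAt (fun p : ℝ × M => (p.1, e p.2)) (0, x) :=
    continuousAt_fst.prodMk
      (ContinuousAt.comp (x := ((0 : ℝ), x)) (e.continuousAt hx) continuousAt_snd)
  filter_upwards [h2.eventually h1, (isOpen_univ.prod e.open_source).mem_nhds
    (show ((0 : ℝ), x) ∈ Set.univ ×ˢ e.source from ⟨Set.mem_univ _, hx⟩)] with p hp hps v hv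
  obtain ⟨t, z⟩ := p
  have hzs : z ∈ e.source := hps.2
  obtain ⟨y, hyt, rfl⟩ : ∃ y ∈ e.target, e.symm y = z :=
    ⟨e z, e.map_source hzs, e.left_inv hzs⟩
  simp only [e.right_inv hyt] at hp
  obtain ⟨w, rfl⟩ := (symmDeriv_bijective he hyt).2 v
  have hw : (stdBasis n).equivFun w ≠ 0 := fun h => hv (by
    have : w = 0 := (stdBasis n).equivFun.map_eq_zero_iff.1 h
    rw [this, map_zero]
    rfl)
  have hval : metricOf (Ω + t • α) (e.symm y) (symmDeriv e y w) (symmDeriv e y w) =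
      (stdBasis n).equivFun w ⬝ᵥ (symMat (inChart (Ω + t • α) e y)).mulVec
        ((stdBasis n).equivFun w) := by
    rw [metricOf_symmDeriv _ he hyt, form_apply_I_smul]
    rfl
  refine lt_of_lt_of_eq ?_ hval.symm
  set c := (stdBasis n).equivFun w
  have hn : 0 < ‖c‖ := norm_pos_iff.2 hw
  have h3 := hp (‖c‖⁻¹ • c) (by
    rw [mem_sphere_zero_iff_norm, norm_smul, norm_inv, norm_norm, inv_mul_cancel₀ hn.ne'])
  rw [Matrix.mulVec_smul, dotProduct_smul, smul_dotProduct, smul_eq_mul, smul_eq_mul] at h3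
  exact pos_of_mul_pos_right (pos_of_mul_pos_right h3 (by positivity)) (by positivity)

end Continuity

/-! ### The volume and its variation -/

section Volume

theorem withDensity_mono_left {X : Type*} [MeasurableSpace X] {μ ν : Measure X} (h : μ ≤ ν)
    (r : X → ENNReal) : μ.withDensity r ≤ ν.withDensity r := by
  refine Measure.le_iff.2 fun s hs => ?_
  rw [withDensity_apply _ hs, withDensity_apply _ hs]
  exact lintegral_mono' (Measure.restrict_mono le_rfl h) le_rfl

/-- Multiplication by an invertible density is an order automorphism of the measures, so that it
commutes with suprema. -/
theorem iSup_withDensity {X ι : Type*} [MeasurableSpace X] {r : X → ENNReal} (hr : Measurable r)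
    (hr0 : ∀ x, r x ≠ 0) (hrt : ∀ x, r x ≠ ⊤) (μ : ι → Measure X) (s : Set ι) :
    ⨆ i ∈ s, (μ i).withDensity r = (⨆ i ∈ s, μ i).withDensity r := by
  refine le_antisymm
    (iSup₂_le fun i hi => withDensity_mono_left (le_iSup₂ (f := fun i _ => μ i) i hi) r) ?_
  set S := ⨆ i ∈ s, (μ i).withDensity r with hS
  have h1 : ⨆ i ∈ s, μ i ≤ S.withDensity r⁻¹ := by
    refine iSup₂_le fun i hi => ?_
    rw [← withDensity_inv_same (μ := μ i) hr (Eventually.of_forall hr0) (Eventually.of_forall hrt)]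
    exact withDensity_mono_left (le_iSup₂ (f := fun i _ => (μ i).withDensity r) i hi) _
  refine (withDensity_mono_left h1 r).trans (le_of_eq ?_)
  have h2 := withDensity_inv_same (μ := S) (f := r⁻¹) hr.inv
    (Eventually.of_forall fun x => ENNReal.inv_ne_zero.2 (hrt x))
    (Eventually.of_forall fun x => ENNReal.inv_ne_top.2 (hr0 x))
  simp only [Pi.inv_apply, inv_inv] at h2
  exact h2

variable {n : ℕ} {M : Type*} [TopologicalSpace M] [ChartedSpace (Cn n) M]
  [IsManifold 𝓘(ℂ, Cn n) ∞ M] [MeasurableSpace M] [BorelSpace M]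

/-- In every chart the volume density of `ω + t α` is `√(det (g + t a) / det g)` times that of
`ω`. -/
theorem chartVol_add_smul {Ω α : DForm n M 2} (hΩ : IsKahlerForm Ω) (hα : IsSmoothForm α)
    (t : ℝ) {e : OpenPartialHomeomorph M (Cn n)}
    (he : e ∈ atlas (Cn n) M) :
    chartVol (metricOf (Ω + t • α)) e =
      (chartVol (metricOf Ω) e).withDensity fun x => ENNReal.ofReal √(detRatio Ω α t x) := by
  have hT : MeasurableSet e.target := e.open_target.measurableSet
  have hr : Measurable fun x => ENNReal.ofReal √(detRatio Ω α t x) := by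
    exact (continuous_detRatio_right hΩ hα t).sqrt.measurable.ennreal_ofReal
  have hmeas : AEMeasurable e.symm ((volume : Measure (Cn n)).restrict e.target) :=
    e.continuousOn_symm.aemeasurable hT
  set d : Cn n → ENNReal := fun y => ENNReal.ofReal √(gramIn (metricOf Ω) e y).det with hd
  have hdm : AEMeasurable d ((volume : Measure (Cn n)).restrict e.target) := by
    refine ContinuousOn.aemeasurable ?_ hT
    have h1 : ContinuousOn (fun y => (gramIn (metricOf Ω) e y).det) e.target :=
      continuous_id.matrix_det.comp_continuousOn
        ((hΩ.1.1.continuousOn_symMat he).congr fun y hy => gramIn_metricOf Ω he hy)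
    exact ENNReal.continuous_ofReal.comp_continuousOn (Real.continuous_sqrt.comp_continuousOn h1)
  have hac : ((volume : Measure (Cn n)).restrict e.target).withDensity d ≪
      (volume : Measure (Cn n)).restrict e.target := withDensity_absolutelyContinuous _ _
  have hrm : AEMeasurable (fun y => ENNReal.ofReal √(detRatio Ω α t (e.symm y)))
      ((volume : Measure (Cn n)).restrict e.target) := hr.comp_aemeasurable hmeas
  have hdens : (volume.withDensity fun y =>
        ENNReal.ofReal √(gramIn (metricOf (Ω + t • α)) e y).det).restrict e.target =
      (((volume : Measure (Cn n)).restrict e.target).withDensity d).withDensity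
        fun y => ENNReal.ofReal √(detRatio Ω α t (e.symm y)) := by
    rw [restrict_withDensity hT, ← withDensity_mul₀ hdm hrm]
    refine withDensity_congr_ae ((ae_restrict_iff' hT).2 (Eventually.of_forall fun y hy => ?_))
    rw [Pi.mul_apply, hd]
    simp only
    rw [← ENNReal.ofReal_mul (Real.sqrt_nonneg _), detRatio_eq_inChart Ω α t he hy,
      gramIn_metricOf _ he hy, gramIn_metricOf _ he hy,
      ← Real.sqrt_mul (hΩ.det_inChart_pos he hy).le,
      mul_div_cancel₀ _ (hΩ.det_inChart_pos he hy).ne']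
  rw [chartVol, hdens, chartVol, restrict_withDensity hT]
  ext s hs
  rw [Measure.map_apply_of_aemeasurable (hmeas.mono_ac
    ((withDensity_absolutelyContinuous _ _).trans hac)) hs, withDensity_apply _ hs,
    Measure.restrict_map_of_aemeasurable (hmeas.mono_ac hac) hs,
    lintegral_map' hr.aemeasurable ((hmeas.mono_ac hac).restrict)]
  rw [withDensity_apply₀ _ ((hmeas.mono_ac hac).nullMeasurable hs)]

theorem volMeasure_add_smul {Ω α : DForm n M 2} (hΩ : IsKahlerForm Ω) (hα : IsSmoothForm α)
    {t : ℝ} (ht : ∀ x, 0 < detRatio Ω α t x) :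
    volMeasure (metricOf (Ω + t • α)) =
      (volMeasure (metricOf Ω)).withDensity fun x => ENNReal.ofReal √(detRatio Ω α t x) := by
  have hr : Measurable fun x => ENNReal.ofReal √(detRatio Ω α t x) := by
    exact (continuous_detRatio_right hΩ hα t).sqrt.measurable.ennreal_ofReal
  rw [volMeasure, volMeasure, ← iSup_withDensity hr
    (fun x => (ENNReal.ofReal_pos.2 (Real.sqrt_pos.2 (ht x))).ne') fun x => ENNReal.ofReal_ne_top]
  exact iSup_congr fun e => iSup_congr fun he => chartVol_add_smul hΩ hα t he

theorem vol_add_smul {Ω α : DForm n M 2} (hΩ : IsKahlerForm Ω) (hα : IsSmoothForm α)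
    {t : ℝ} (ht : ∀ x, 0 < detRatio Ω α t x) :
    vol (metricOf (Ω + t • α)) = ∫ x, √(detRatio Ω α t x) ∂volMeasure (metricOf Ω) := by
  rw [vol, volMeasure_add_smul hΩ hα ht, Measure.real, withDensity_apply _ MeasurableSet.univ,
    Measure.restrict_univ, integral_eq_lintegral_of_nonneg_ae
      (Eventually.of_forall fun x => Real.sqrt_nonneg _)
      (continuous_detRatio_right hΩ hα t).sqrt.measurable.aestronglyMeasurable]

/-- The first variation of the total volume. -/
theorem hasDerivAt_vol [CompactSpace M] {Ω α : DForm n M 2} (hΩ : IsKahlerForm Ω)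
    (hα : IsSmoothForm α) [IsFiniteMeasure (volMeasure (metricOf Ω))] :
    HasDerivAt (fun t : ℝ => vol (metricOf (Ω + t • α)))
      (∫ x, formInner (metricOf Ω) x (α x) (Ω x) ∂volMeasure (metricOf Ω)) 0 := by
  have hpos := eventually_detRatio_gt hΩ hα
  have hc' := continuous_detRatioDeriv_right hΩ hα 0
  have hev : (fun t : ℝ => vol (metricOf (Ω + t • α))) =ᶠ[𝓝 0]
      fun t => ∫ x, √(detRatio Ω α t x) ∂volMeasure (metricOf Ω) := by
    filter_upwards [hpos] with t ht
    exact vol_add_smul hΩ hα fun x => by linarith [ht x]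
  refine HasDerivAt.congr_of_eventuallyEq ?_ hev
  obtain ⟨C, hC⟩ := (isCompact_Icc.prod isCompact_univ :
    IsCompact (Set.Icc (-1 : ℝ) 1 ×ˢ (Set.univ : Set M))).exists_bound_of_continuousOn
      (continuous_detRatioDeriv hΩ hα).continuousOn
  have hs : {t : ℝ | ∀ x : M, 1 / 4 < detRatio Ω α t x} ∩ Set.Icc (-1) 1 ∈ 𝓝 (0 : ℝ) :=
    inter_mem hpos (Icc_mem_nhds (by norm_num) (by norm_num))
  have hval : ∀ x, detRatioDeriv Ω α 0 x / (2 * √(detRatio Ω α 0 x)) =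
      formInner (metricOf Ω) x (α x) (Ω x) := fun x => by
    rw [detRatioDeriv_zero hΩ, detRatio_zero hΩ, Real.sqrt_one]
    ring
  have key := hasDerivAt_integral_of_dominated_loc_of_deriv_le
    (μ := volMeasure (metricOf Ω)) (F := fun t x => √(detRatio Ω α t x))
    (F' := fun t x => detRatioDeriv Ω α t x / (2 * √(detRatio Ω α t x)))
    (bound := fun _ => C) hs
    (Eventually.of_forall fun t =>
      (continuous_detRatio_right hΩ hα t).sqrt.measurable.aestronglyMeasurable)
    (by
      simp only [detRatio_zero hΩ]
      exact integrable_const _)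
    (by
      simp only [detRatio_zero hΩ]
      exact (hc'.div_const _).measurable.aestronglyMeasurable)
    (Eventually.of_forall fun x t ht => by
      -- The ratio exceeds `1/4`, so that `2 √ratio ≥ 1`.
      have h1 : 1 ≤ 2 * √(detRatio Ω α t x) := by
        have h2 : (1 : ℝ) / 2 ≤ √(detRatio Ω α t x) := Real.le_sqrt_of_sq_le (by
          have := ht.1 x
          norm_num
          linarith)
        linarith
      rw [norm_div, Real.norm_of_nonneg (by positivity : 0 ≤ 2 * √(detRatio Ω α t x))]
      exact (div_le_self (norm_nonneg _) h1).trans (hC (t, x) ⟨ht.2, Set.mem_univ x⟩))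
    (integrable_const _)
    (Eventually.of_forall fun x t ht =>
      (hasDerivAt_detRatio Ω α t x).sqrt (by linarith [ht.1 x]))
  have h2 := key.2
  simp only [hval] at h2
  exact h2

end Volume

/-! ### The quadratic form on an eigenspace -/

section Projection

variable {n : ℕ} {M : Type*} [TopologicalSpace M] [ChartedSpace (Cn n) M]

theorem formInner_smul_left (g : BilinField n M) (x : M) (c : ℝ)
    (β γ : Tan n x [⋀^Fin 2]→L[ℝ] ℝ) : formInner g x (c • β) γ = c * formInner g x β γ := by
  simp only [formInner, Finset.mul_sum]
  refine Finset.sum_congr rfl fun a _ => Finset.sum_congr rfl fun b _ =>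
    Finset.sum_congr rfl fun k _ => Finset.sum_congr rfl fun d _ => ?_
  rw [ContinuousAlternatingMap.smul_apply, smul_eq_mul]
  ring

theorem memLp_of_continuous [CompactSpace M] [MeasurableSpace M] [BorelSpace M] {μ : Measure M}
    [IsFiniteMeasure μ] {φ : M → ℝ} (hφ : Continuous φ) (p : ENNReal) : MemLp φ p μ := by
  obtain ⟨C, hC⟩ := isCompact_univ.exists_bound_of_continuousOn hφ.continuousOn
  exact MemLp.of_bound hφ.measurable.aestronglyMeasurable C
    (Eventually.of_forall fun x => hC x (Set.mem_univ x))

/-- The orthogonal projection to the eigenspace does not affect the pairing with an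
eigenfunction. -/
theorem quadForm_eq_integral [MeasurableSpace M] {Ω α : DForm n M 2} {lam : ℝ} {f : M → ℝ}
    (hf : IsEigenfunction (metricOf Ω) lam f) (hfL : MemLp f 2 (volMeasure (metricOf Ω)))
    (hv : MemLp (laplacianVariation Ω α f) 2 (volMeasure (metricOf Ω))) :
    quadForm Ω α lam f = ∫ x, f x * laplacianVariation Ω α f x ∂volMeasure (metricOf Ω) := by
  have : CompleteSpace (eigenspaceL2 (metricOf Ω) lam) :=
    (Submodule.isClosed_topologicalClosure _).completeSpace_coe
  have hmem : hfL.toLp f ∈ eigenspaceL2 (metricOf Ω) lam :=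
    Submodule.le_topologicalClosure _ (Submodule.subset_span ⟨f, hf, hfL.coeFn_toLp⟩)
  have hproj : projectedVariation Ω α lam f =
      (eigenspaceL2 (metricOf Ω) lam).starProjection (hv.toLp (laplacianVariation Ω α f)) := by
    rw [projectedVariation, classL2, dif_pos hv]
  have horth := (eigenspaceL2 (metricOf Ω) lam).starProjection_inner_eq_zero
    (hv.toLp (laplacianVariation Ω α f)) (hfL.toLp f) hmem
  rw [← hproj, inner_sub_left, sub_eq_zero] at horth
  rw [L2.inner_def, L2.inner_def] at horth
  have h1 : quadForm Ω α lam f = ∫ x, inner ℝ (projectedVariation Ω α lam f x) (hfL.toLp f x)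
      ∂volMeasure (metricOf Ω) := by
    refine integral_congr_ae ?_
    filter_upwards [hfL.coeFn_toLp] with x hx
    rw [hx]
    simp
  rw [h1, ← horth]
  refine integral_congr_ae ?_
  filter_upwards [hfL.coeFn_toLp, hv.coeFn_toLp] with x hx hx'
  rw [hx, hx']
  simp

end Projection

end KahlerDeformation

end

open KahlerDeformation
theorem mainTheorem3 {n : ℕ} (hn : 0 < n) {M : Type*} [TopologicalSpace M] [T2Space M]
    [CompactSpace M] [ChartedSpace (Cn n) M] [IsManifold 𝓘(ℂ, Cn n) ∞ M]
    [MeasurableSpace M] [BorelSpace M]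
    (Ω : DForm n M 2) (hΩ : IsKahlerForm Ω)
    (hvol : volMeasure (metricOf Ω) Set.univ = 1)
    (α : DForm n M 2) (hα : IsClosedOneOneZero Ω α) :
    (∀ᶠ t : ℝ in 𝓝 0, IsKahlerForm (Ω + t • α)) ∧
    (∀ f : M → ℝ, ContMDiff 𝓘(ℝ, Cn n) 𝓘(ℝ, ℝ) ∞ f →
      (∀ x, HasDerivAt (fun t : ℝ => laplacian (deformedMetric Ω α t) f x)
        (formInner (metricOf Ω) x (ddc n f x) (α x)) 0) ∧
      Integrable (fun x => formInner (metricOf Ω) x (f x • ddc n f x) (α x))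
        (volMeasure (metricOf Ω)) ∧
      ∫ x, f x * laplacianVariation Ω α f x ∂volMeasure (metricOf Ω) =
        ∫ x, formInner (metricOf Ω) x (f x • ddc n f x) (α x) ∂volMeasure (metricOf Ω)) ∧
    (∀ (lam : ℝ) (f : M → ℝ), IsEigenfunction (metricOf Ω) lam f →
      MemLp (laplacianVariation Ω α f) 2 (volMeasure (metricOf Ω)) ∧
      quadForm Ω α lam f =
        ∫ x, formInner (metricOf Ω) x (f x • ddc n f x) (α x) ∂volMeasure (metricOf Ω)) := by
  have : IsFiniteMeasure (volMeasure (metricOf Ω)) := ⟨by rw [hvol]; exact ENNReal.one_lt_top⟩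
  have hvol0 : vol (metricOf (Ω + (0 : ℝ) • α)) = 1 := by
    have h0 : Ω + (0 : ℝ) • α = Ω := by
      funext x
      refine ContinuousAlternatingMap.ext fun v => ?_
      change Ω x v + 0 * α x v = Ω x v
      ring
    rw [h0, vol, Measure.real, hvol, ENNReal.toReal_one]
  have hc0 : vol (metricOf (Ω + (0 : ℝ) • α)) ^ (-1 / (n : ℝ)) = 1 := by
    rw [hvol0, Real.one_rpow]
  -- The volume is stationary at `t = 0`, because `∫ g(α, ω) dμ = 0`.
  have hc : HasDerivAt (fun t : ℝ => vol (metricOf (Ω + t • α)) ^ (-1 / (n : ℝ))) 0 0 := by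
    have h1 := hasDerivAt_vol hΩ hα.1.1
    rw [hα.2] at h1
    simpa using h1.rpow_const (p := -1 / (n : ℝ)) (Or.inl (by rw [hvol0]; exact one_ne_zero))
  have hderiv : ∀ f : M → ℝ, ContMDiff 𝓘(ℝ, Cn n) 𝓘(ℝ, ℝ) ∞ f → ∀ x,
      HasDerivAt (fun t : ℝ => laplacian (deformedMetric Ω α t) f x)
        (formInner (metricOf Ω) x (ddc n f x) (α x)) 0 := fun f hf x =>
    hasDerivAt_laplacian hΩ hα.1 hc0 hc hf x
  have hcont : ∀ f : M → ℝ, ContMDiff 𝓘(ℝ, Cn n) 𝓘(ℝ, ℝ) ∞ f →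
      Continuous fun x => formInner (metricOf Ω) x (ddc n f x) (α x) := fun f hf =>
    continuous_formInner_ddc hΩ hα.1.1 hf
  have hvar : ∀ f : M → ℝ, ContMDiff 𝓘(ℝ, Cn n) 𝓘(ℝ, ℝ) ∞ f → laplacianVariation Ω α f =
      fun x => formInner (metricOf Ω) x (ddc n f x) (α x) := fun f hf =>
    funext fun x => (hderiv f hf x).deriv
  have hint : ∀ f : M → ℝ, ContMDiff 𝓘(ℝ, Cn n) 𝓘(ℝ, ℝ) ∞ f →
      ∫ x, f x * laplacianVariation Ω α f x ∂volMeasure (metricOf Ω) =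
        ∫ x, formInner (metricOf Ω) x (f x • ddc n f x) (α x) ∂volMeasure (metricOf Ω) :=
    fun f hf => by simp only [hvar f hf, formInner_smul_left]
  refine ⟨eventually_isKahlerForm hΩ hα.1, fun f hf => ⟨hderiv f hf, ?_, hint f hf⟩,
    fun lam f hf => ?_⟩
  · simp only [formInner_smul_left]
    exact memLp_one_iff_integrable.1 (memLp_of_continuous (hf.continuous.mul (hcont f hf)) 1)
  · have hv : MemLp (laplacianVariation Ω α f) 2 (volMeasure (metricOf Ω)) := by
      rw [hvar f hf.1]
      exact memLp_of_continuous (hcont f hf.1) 2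
    refine ⟨hv, ?_⟩
    rw [quadForm_eq_integral hf (memLp_of_continuous hf.1.continuous 2) hv, hint f hf.1]
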